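/- Let $\Bbbk$ be a field, $H$ a Hopf algebra over $\Bbbk$ with coproduct $\Delta(h)=h_1\otimes h_2$, counit $\epsilon$ and antipode $S$, and let $A$ be a right $H$-comodule algebra with coaction $\Delta_A(a)=a_0\otimes a_1$ such that $B:=A^{\mathrm{co}H}=\{a:\Delta_A(a)=a\otimes 1\}\subseteq A$ is a quantum principal bundle, i.e. a faithfully flat Hopf–Galois extension: $A$ is a faithfully flat left $B$-module and $\chi:A\otimes_BA\to A\otimes H$, $a\otimes_B a'\mapsto aa'_0\otimes a'_1$, is bijective. Let $(\Gamma,\mathrm d)$ be a bicovariant first order differential calculus on $H$: an $H$-bimodule $\Gamma$ with a linear map $\mathrm d:H\to\Gamma$ such that $\mathrm d(hg)=(\mathrm dh)g+h\,\mathrm dg$ and $\Gamma=\mathrm{span}\{h\,\mathrm dg\}$, together with a left and a right $H$-coaction on $\Gamma$, both compatible with the bimodule structure and such that $\mathrm d$ is left and right colinear. Let $\Gamma^\wedge$ be the maximal prolongation of $\Gamma$, i.e. the quotient of the tensor algebra $H\oplus\Gamma\oplus(\Gamma\otimes_H\Gamma)\oplus\cdots$ by the two-sided ideal generated by all $\sum_i\mathrm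 da^i\otimes_H\mathrm db^i$ with $\sum_ia^i\mathrm db^i=0$, with its grading, its product $\wedge$, its differential $\mathrm d$ (the unique extension of $\mathrm d:H\to\Gamma$ to a square-zero graded derivation of degree one) and the left coaction ${}_{\Gamma^\wedge}\Delta:\Gamma^\wedge\to H\otimes\Gamma^\wedge$ (the algebra map that extends $\Delta$ and the left coaction of $\Gamma$). Let $\Lambda^n=\{\omega\in\Gamma^{\wedge n}:{}_{\Gamma^\wedge}\Delta(\omega)=1\otimes\omega\}$ and $\Lambda^\bullet=\bigoplus_{n\ge0}\Lambda^n$, which is a subalgebra stable under $\mathrm d$; let $\theta\leftharpoonup h=S(h_1)\theta h_2$ for $\theta\in\Lambda^\bullet$, $h\in H$; let $\pi_\epsilon:H\to H^+=\ker\epsilon$, $\pi_\epsilon(h)=h-\epsilon(h)1$; and let $\varpi:H^+\to\Lambda^1$, $\varpi(h)=S(h_1)\mathrm dh_2$, be the quantum Maurer–Cartan form. Then the graded vector space of vertical forms $\mathfrak{ver}^\bullet(A)=A\otimes\Lambda^\bullet$, $\mathfrak{ver}^n(A)=A\otimes\Lambda^n$, with $$(a\otimes\theta)\wedge(b\otimes\eta)=ab_0\otimes(\theta\leftharpoonup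 b_1)\wedge\eta,\qquad \mathrm d(a\otimes\theta)=a\otimes\mathrm d\theta+a_0\otimes\varpi(\pi_\epsilon(a_1))\wedge\theta$$ for $a,b\in A$ and $\theta,\eta\in\Lambda^\bullet$, is a differential calculus over $A$. That is: $\wedge$ is associative, of degree $0$, with unit $1\otimes1$; $\mathrm d$ is of degree $1$, $\mathrm d^2=0$ and $\mathrm d(x\wedge y)=\mathrm dx\wedge y+(-1)^{n}x\wedge\mathrm dy$ for $x\in\mathfrak{ver}^n(A)$ and all $y$; the map $a\mapsto a\otimes1$ is an algebra isomorphism of $A$ onto $\mathfrak{ver}^0(A)$; and $\mathfrak{ver}^n(A)=\mathrm{span}_{\Bbbk}\{a^0\wedge\mathrm da^1\wedge\cdots\wedge\mathrm da^n: a^0,\dots,a^n\in A\}$ for every $n\ge0$. -/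

import Mathlib

open scoped TensorProduct RightActions

set_option linter.unusedSectionVars false

noncomputable section

namespace QPB

/-! ### Balanced tensor products and faithful flatness over a noncommutative ring -/

section Balanced

universe u v w

variable (R : Type u) [Ring R]

/-- The subgroup of `X ⊗ Y` generated by all `x r ⊗ y - x ⊗ r y`. -/
def balancedRel (X : Type v) (Y : Type w) [AddCommGroup X] [Module Rᵐᵒᵖ X]
    [AddCommGroup Y] [Module R Y] : AddSubgroup (X ⊗[ℤ] Y) :=
  AddSubgroup.closure {t | ∃ (x : X) (r : R) (y : Y), t = (x <• r) ⊗ₜ[ℤ] y - x ⊗ₜ[ℤ] (r • y)}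

/-- The tensor product `X ⊗_R Y` of a right `R`-module and a left `R`-module
(as an abelian group). -/
abbrev BalancedTensor (X : Type v) (Y : Type w) [AddCommGroup X] [Module Rᵐᵒᵖ X]
    [AddCommGroup Y] [Module R Y] : Type (max v w) :=
  (X ⊗[ℤ] Y) ⧸ balancedRel R X Y

/-- The map `f ⊗_R id : X ⊗_R Y → X' ⊗_R Y`. -/
def balancedMap {X X' : Type v} (Y : Type w) [AddCommGroup X] [Module Rᵐᵒᵖ X]
    [AddCommGroup X'] [Module Rᵐᵒᵖ X'] [AddCommGroup Y] [Module R Y] (f : X →ₗ[Rᵐᵒᵖ] X') :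
    BalancedTensor R X Y →+ BalancedTensor R X' Y :=
  QuotientAddGroup.map _ _ (LinearMap.rTensor Y f.toAddMonoidHom.toIntLinearMap).toAddMonoidHom <| by
    refine (AddSubgroup.closure_le _).2 ?_
    rintro _ ⟨x, r, y, rfl⟩
    refine AddSubgroup.subset_closure ⟨f x, r, y, ?_⟩
    rw [map_sub]
    exact congrArg (fun z => z ⊗ₜ[ℤ] y - f x ⊗ₜ[ℤ] (r • y)) (f.map_smul _ x)

/-- `0 → X → Y → Z → 0` is a short exact sequence. -/
def IsShortExact {X Y Z : Type*} [AddCommGroup X] [AddCommGroup Y] [AddCommGroup Z]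
    (f : X → Y) (g : Y → Z) : Prop :=
  Function.Injective f ∧ Function.Exact f g ∧ Function.Surjective g

/-- The left `R`-module `Y` is faithfully flat: a sequence of right `R`-modules is short exact
if and only if it is so after applying `- ⊗_R Y`. -/
def IsFaithfullyFlat (Y : Type w) [AddCommGroup Y] [Module R Y] : Prop :=
  ∀ (X₁ X₂ X₃ : Type u) [AddCommGroup X₁] [AddCommGroup X₂] [AddCommGroup X₃]
    [Module Rᵐᵒᵖ X₁] [Module Rᵐᵒᵖ X₂] [Module Rᵐᵒᵖ X₃]
    (f : X₁ →ₗ[Rᵐᵒᵖ] X₂) (g : X₂ →ₗ[Rᵐᵒᵖ] X₃),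
    IsShortExact f g ↔ IsShortExact (balancedMap R Y f) (balancedMap R Y g)

end Balanced

/-! ### Comodule algebras and quantum principal bundles -/

/-- A right `H`-comodule algebra structure on `A`. -/
structure RightComoduleAlgebra (k H A : Type*) [Field k] [Ring H] [HopfAlgebra k H]
    [Ring A] [Algebra k A] where
  /-- The coaction `a ↦ a₀ ⊗ a₁`. -/
  coact : A →ₐ[k] A ⊗[k] H
  coassoc : (TensorProduct.assoc k A H H).toLinearMap ∘ₗ
      LinearMap.rTensor H coact.toLinearMap ∘ₗ coact.toLinearMap =
    LinearMap.lTensor A (Coalgebra.comul (R := k) (A := H)) ∘ₗ coact.toLinearMap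
  counit : LinearMap.lTensor A (Coalgebra.counit (R := k) (A := H)) ∘ₗ coact.toLinearMap =
    (TensorProduct.mk k A k).flip 1

namespace RightComoduleAlgebra

variable {k H A : Type*} [Field k] [Ring H] [HopfAlgebra k H] [Ring A] [Algebra k A]
  (P : RightComoduleAlgebra k H A)

/-- The base `B = A^{co H} = {a | Δ_A(a) = a ⊗ 1}`. -/
def base : Subalgebra k A :=
  AlgHom.equalizer P.coact Algebra.TensorProduct.includeLeft

/-- `A` as a right module over the base, by multiplication. -/
instance rightModule : Module (P.base)ᵐᵒᵖ A :=
  Module.compHom A (RingHom.op P.base.val.toRingHom)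

/-- The map `A ⊗ A → A ⊗ H`, `a ⊗ a' ↦ a a'₀ ⊗ a'₁`. -/
def canonicalMapAux : A ⊗[ℤ] A →+ A ⊗[k] H :=
  TensorProduct.liftAddHom (AddMonoidHom.mk' (fun a : A =>
      AddMonoidHom.mk' (fun a' : A => (a ⊗ₜ[k] (1 : H)) * P.coact a')
        (fun x y => by rw [map_add, mul_add]))
      (fun x y => by ext z; simp [TensorProduct.add_tmul, add_mul]))
    (fun n a b => by
      have h : (n • a) ⊗ₜ[k] (1 : H) = n • (a ⊗ₜ[k] (1 : H)) :=
        map_zsmul ((TensorProduct.mk k A H).flip 1) n a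
      change (n • a) ⊗ₜ[k] (1 : H) * P.coact b = a ⊗ₜ[k] (1 : H) * P.coact (n • b)
      rw [h, map_zsmul, smul_mul_assoc, mul_smul_comm])

/-- The canonical map `χ : A ⊗_B A → A ⊗ H`, `a ⊗ a' ↦ a a'₀ ⊗ a'₁`. -/
def canonicalMap : BalancedTensor P.base A A →+ A ⊗[k] H :=
  QuotientAddGroup.lift (balancedRel P.base A A) P.canonicalMapAux <| by
    refine (AddSubgroup.closure_le _).2 ?_
    rintro _ ⟨x, r, y, rfl⟩
    have hr : P.coact (r : A) = (r : A) ⊗ₜ[k] (1 : H) := r.2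
    have h : (x * (r : A)) ⊗ₜ[k] (1 : H) * P.coact y =
        x ⊗ₜ[k] (1 : H) * P.coact ((r : A) * y) := by
      rw [map_mul, hr, ← mul_assoc, Algebra.TensorProduct.tmul_mul_tmul, one_mul]
    rw [SetLike.mem_coe, AddMonoidHom.mem_ker, map_sub, sub_eq_zero]
    exact h

/-- `B ⊆ A` is a quantum principal bundle: a faithfully flat Hopf-Galois extension. -/
structure IsQuantumPrincipalBundle : Prop where
  galois : Function.Bijective P.canonicalMap
  faithfullyFlat : IsFaithfullyFlat P.base A

end RightComoduleAlgebra

/-! ### First order differential calculi -/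

section FirstOrder

variable (k A Γ : Type*) [Field k] [Ring A] [Algebra k A] [AddCommGroup Γ] [Module k Γ]
  [Module A Γ] [Module Aᵐᵒᵖ Γ] [SMulCommClass A Aᵐᵒᵖ Γ] [IsScalarTower k A Γ]
  [IsScalarTower k Aᵐᵒᵖ Γ]

/-- The left action of `A` on the bimodule `Γ` as a bilinear map. -/
def leftAct : A →ₗ[k] Γ →ₗ[k] Γ :=
  LinearMap.mk₂ k (fun a ω => a • ω) add_smul (fun c a ω => smul_assoc c a ω) smul_add
    (fun c a ω => by rw [← algebraMap_smul A c ω, ← algebraMap_smul A c (a • ω), smul_smul,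
      smul_smul, Algebra.commutes])

/-- The right action of `A` on the bimodule `Γ` as a bilinear map. -/
def rightAct : Γ →ₗ[k] A →ₗ[k] Γ :=
  (LinearMap.mk₂ k (fun (a : A) (ω : Γ) => ω <• a) (fun a b ω => by
      rw [MulOpposite.op_add, add_smul]) (fun c a ω => by
      rw [MulOpposite.op_smul, smul_assoc]) (fun a ω η => smul_add _ _ _)
    (fun c a ω => by rw [← algebraMap_smul Aᵐᵒᵖ c ω, ← algebraMap_smul Aᵐᵒᵖ c (ω <• a), smul_smul,
      smul_smul, Algebra.commutes])).flip

/-- A first order differential calculus on the `k`-algebra `A` with space of 1-forms the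
`A`-bimodule `Γ`. -/
structure FirstOrderCalculus where
  d : A →ₗ[k] Γ
  leibniz : ∀ a b, d (a * b) = d a <• b + a • d b
  span_eq_top : Submodule.span k {ω | ∃ a b : A, ω = a • d b} = ⊤

end FirstOrder

section Covariant

variable (k H Γ : Type*) [Field k] [Ring H] [HopfAlgebra k H] [AddCommGroup Γ] [Module k Γ]
  [Module H Γ] [Module Hᵐᵒᵖ Γ] [SMulCommClass H Hᵐᵒᵖ Γ] [IsScalarTower k H Γ]
  [IsScalarTower k Hᵐᵒᵖ Γ]

open Coalgebra in
/-- A left covariant first order calculus on the Hopf algebra `H`: `Γ` carries a left coaction,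
compatible with the bimodule structure (`h ω h' ↦ Δ(h) Δ(ω) Δ(h')`), for which `d` is colinear. -/
structure LeftCovariantCalculus extends FirstOrderCalculus k H Γ where
  lcoact : Γ →ₗ[k] H ⊗[k] Γ
  lcoassoc : (TensorProduct.assoc k H H Γ).toLinearMap ∘ₗ
      LinearMap.rTensor Γ (comul (R := k) (A := H)) ∘ₗ lcoact =
    LinearMap.lTensor H lcoact ∘ₗ lcoact
  lcounit : LinearMap.rTensor Γ (counit (R := k) (A := H)) ∘ₗ lcoact = TensorProduct.mk k k Γ 1
  lcoact_smul : ∀ (h : H) (ω : Γ), lcoact (h • ω) =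
    TensorProduct.map₂ (LinearMap.mul k H) (leftAct k H Γ) (comul h) (lcoact ω)
  lcoact_op_smul : ∀ (h : H) (ω : Γ), lcoact (ω <• h) =
    TensorProduct.map₂ (LinearMap.mul k H) (rightAct k H Γ) (lcoact ω) (comul h)
  lcoact_d : lcoact ∘ₗ d = LinearMap.lTensor H d ∘ₗ comul

open Coalgebra in
/-- A bicovariant first order calculus on the Hopf algebra `H`: both left and right covariant. -/
structure BicovariantCalculus extends LeftCovariantCalculus k H Γ where
  rcoact : Γ →ₗ[k] Γ ⊗[k] H
  rcoassoc : (TensorProduct.assoc k Γ H H).toLinearMap ∘ₗ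
      LinearMap.rTensor H rcoact ∘ₗ rcoact =
    LinearMap.lTensor Γ (comul (R := k) (A := H)) ∘ₗ rcoact
  rcounit : LinearMap.lTensor Γ (counit (R := k) (A := H)) ∘ₗ rcoact =
    (TensorProduct.mk k Γ k).flip 1
  rcoact_smul : ∀ (h : H) (ω : Γ), rcoact (h • ω) =
    TensorProduct.map₂ (leftAct k H Γ) (LinearMap.mul k H) (comul h) (rcoact ω)
  rcoact_op_smul : ∀ (h : H) (ω : Γ), rcoact (ω <• h) =
    TensorProduct.map₂ (rightAct k H Γ) (LinearMap.mul k H) (rcoact ω) (comul h)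
  rcoact_d : rcoact ∘ₗ d = LinearMap.rTensor H d ∘ₗ comul

end Covariant

/-! ### The tensor algebra of a bimodule -/

section BimoduleTensorAlgebra

variable (k A Γ : Type*) [Field k] [Ring A] [Algebra k A] [AddCommGroup Γ] [Module k Γ]
  [Module A Γ] [Module Aᵐᵒᵖ Γ]

/-- The relations that present the tensor algebra of the `A`-bimodule `Γ` as a quotient of the
free `k`-algebra on the vector space `A × Γ`. -/
inductive BimoduleTensorRel : TensorAlgebra k (A × Γ) → TensorAlgebra k (A × Γ) → Prop
  | one : BimoduleTensorRel (TensorAlgebra.ι k (1, 0)) 1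
  | mul (a b : A) : BimoduleTensorRel
      (TensorAlgebra.ι k (a, 0) * TensorAlgebra.ι k (b, 0)) (TensorAlgebra.ι k (a * b, 0))
  | left (a : A) (ω : Γ) : BimoduleTensorRel
      (TensorAlgebra.ι k (a, 0) * TensorAlgebra.ι k (0, ω)) (TensorAlgebra.ι k (0, a • ω))
  | right (a : A) (ω : Γ) : BimoduleTensorRel
      (TensorAlgebra.ι k (0, ω) * TensorAlgebra.ι k (a, 0)) (TensorAlgebra.ι k (0, ω <• a))

/-- The tensor algebra `A ⊕ Γ ⊕ (Γ ⊗_A Γ) ⊕ ⋯` of the `A`-bimodule `Γ`, in its presentation as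
the universal `k`-algebra that receives an algebra map from `A` and an `A`-bimodule map
from `Γ`; see `BimoduleTensorAlgebra.lift`. -/
def BimoduleTensorAlgebra : Type _ := RingQuot (BimoduleTensorRel k A Γ)

namespace BimoduleTensorAlgebra

instance : Ring (BimoduleTensorAlgebra k A Γ) :=
  inferInstanceAs (Ring (RingQuot (BimoduleTensorRel k A Γ)))

instance : Algebra k (BimoduleTensorAlgebra k A Γ) :=
  inferInstanceAs (Algebra k (RingQuot (BimoduleTensorRel k A Γ)))

/-- The quotient map from the free algebra. -/
def mk : TensorAlgebra k (A × Γ) →ₐ[k] BimoduleTensorAlgebra k A Γ :=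
  RingQuot.mkAlgHom k (BimoduleTensorRel k A Γ)

variable {k A Γ} in
theorem mk_rel {x y} (h : BimoduleTensorRel k A Γ x y) : mk k A Γ x = mk k A Γ y :=
  RingQuot.mkAlgHom_rel k h

/-- The inclusion of `A` (degree 0). -/
def ofAlg : A →ₐ[k] BimoduleTensorAlgebra k A Γ :=
  AlgHom.ofLinearMap
    ((mk k A Γ).toLinearMap ∘ₗ TensorAlgebra.ι k ∘ₗ LinearMap.inl k A Γ)
    (by simpa using mk_rel (BimoduleTensorRel.one (k := k) (A := A) (Γ := Γ)))
    (fun a b => by simpa using (mk_rel (BimoduleTensorRel.mul (k := k) (Γ := Γ) a b)).symm)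

/-- The inclusion of `Γ` (degree 1). -/
def ofForm : Γ →ₗ[k] BimoduleTensorAlgebra k A Γ :=
  (mk k A Γ).toLinearMap ∘ₗ TensorAlgebra.ι k ∘ₗ LinearMap.inr k A Γ

theorem ofForm_smul (a : A) (ω : Γ) :
    ofForm k A Γ (a • ω) = ofAlg k A Γ a * ofForm k A Γ ω := by
  simpa [ofForm, ofAlg] using (mk_rel (BimoduleTensorRel.left (k := k) a ω)).symm

theorem ofForm_op_smul (a : A) (ω : Γ) :
    ofForm k A Γ (ω <• a) = ofForm k A Γ ω * ofAlg k A Γ a := by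
  simpa [ofForm, ofAlg] using (mk_rel (BimoduleTensorRel.right (k := k) a ω)).symm

variable {k A Γ} {C : Type*} [Ring C] [Algebra k C]

/-- The universal property of the tensor algebra of a bimodule. -/
def lift (f : A →ₐ[k] C) (g : Γ →ₗ[k] C) (hl : ∀ a ω, g (a • ω) = f a * g ω)
    (hr : ∀ a ω, g (ω <• a) = g ω * f a) : BimoduleTensorAlgebra k A Γ →ₐ[k] C :=
  RingQuot.liftAlgHom k ⟨TensorAlgebra.lift k (LinearMap.coprod f.toLinearMap g), by
    rintro _ _ (_ | _ | _ | _) <;> simp [hl, hr]⟩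

variable (f : A →ₐ[k] C) (g : Γ →ₗ[k] C) (hl : ∀ a ω, g (a • ω) = f a * g ω)
  (hr : ∀ a ω, g (ω <• a) = g ω * f a)

theorem lift_mk (x) : lift f g hl hr (mk k A Γ x) =
    TensorAlgebra.lift k (LinearMap.coprod f.toLinearMap g) x :=
  RingQuot.liftAlgHom_mkAlgHom_apply _ _ _ _

@[simp] theorem lift_ofAlg (a : A) : lift f g hl hr (ofAlg k A Γ a) = f a := by
  have := lift_mk f g hl hr (TensorAlgebra.ι k (a, 0))
  simpa [ofAlg] using this

@[simp] theorem lift_ofForm (ω : Γ) : lift f g hl hr (ofForm k A Γ ω) = g ω := by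
  have := lift_mk f g hl hr (TensorAlgebra.ι k (0, ω))
  simpa [ofForm] using this

theorem hom_ext {φ ψ : BimoduleTensorAlgebra k A Γ →ₐ[k] C}
    (h0 : ∀ a, φ (ofAlg k A Γ a) = ψ (ofAlg k A Γ a))
    (h1 : ∀ ω, φ (ofForm k A Γ ω) = ψ (ofForm k A Γ ω)) : φ = ψ := by
  refine RingQuot.ringQuot_ext' k (A := TensorAlgebra k (A × Γ)) φ ψ ?_
  refine TensorAlgebra.hom_ext ?_
  ext x
  · exact h0 x
  · exact h1 x

end BimoduleTensorAlgebra

end BimoduleTensorAlgebra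

/-! ### Upper triangular matrices -/

section Upper

variable {k E V W X : Type*} [Field k] [Ring E] [Algebra k E] [AddCommGroup V] [Module k V]
  [AddCommGroup W] [Module k W] [AddCommGroup X] [Module k X]

/-- The matrix valued linear map `v ↦ (x v, y v; 0, z v)`. -/
def upper (x y z : V →ₗ[k] E) : V →ₗ[k] Matrix (Fin 2) (Fin 2) E where
  toFun v := !![x v, y v; 0, z v]
  map_add' v w := by ext i j; fin_cases i <;> fin_cases j <;> simp
  map_smul' c v := by ext i j; fin_cases i <;> fin_cases j <;> simp

theorem upper_apply (x y z : V →ₗ[k] E) (v : V) : upper x y z v = !![x v, y v; 0, z v] := rfl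

theorem upper_one (x y z : V →ₗ[k] E) (v : V) (hx : x v = 1) (hy : y v = 0) (hz : z v = 1) :
    upper x y z v = 1 := by
  rw [upper_apply, hx, hy, hz, Matrix.one_fin_two]

theorem upper_mul (x y z : V →ₗ[k] E) (x' y' z' : W →ₗ[k] E) (x'' y'' z'' : X →ₗ[k] E)
    (v : V) (w : W) (u : X) (hx : x v = x' w * x'' u) (hy : y v = x' w * y'' u + y' w * z'' u)
    (hz : z v = z' w * z'' u) : upper x y z v = upper x' y' z' w * upper x'' y'' z'' u := by
  simp only [upper_apply, hx, hy, hz, Matrix.mul_fin_two]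
  simp

theorem upper_sum {n : ℕ} (x y z : V →ₗ[k] E) (v w : Fin n → V)
    (hx : ∑ i, x (v i) * x (w i) = 0) (hy : ∑ i, (x (v i) * y (w i) + y (v i) * z (w i)) = 0)
    (hz : ∑ i, z (v i) * z (w i) = 0) : ∑ i, upper x y z (v i) * upper x y z (w i) = 0 := by
  ext i j
  fin_cases i <;> fin_cases j <;>
    simp [Matrix.sum_apply, upper_apply, hx, hy, hz]

end Upper

/-! ### The maximal prolongation -/

section MaximalProlongation

variable {k A Γ : Type*} [Field k] [Ring A] [Algebra k A] [AddCommGroup Γ] [Module k Γ]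
  [Module A Γ] [Module Aᵐᵒᵖ Γ]

namespace FirstOrderCalculus

/-- The generators `∑ᵢ d aᵢ ⊗ d bᵢ`, where `∑ᵢ aᵢ d bᵢ = 0`, of the ideal that is divided out. -/
inductive ProlongationRel (C : FirstOrderCalculus k A Γ) :
    BimoduleTensorAlgebra k A Γ → BimoduleTensorAlgebra k A Γ → Prop
  | mk (n : ℕ) (a b : Fin n → A) (h : ∑ i, a i • C.d (b i) = 0) : ProlongationRel C
      (∑ i, BimoduleTensorAlgebra.ofForm k A Γ (C.d (a i)) *
        BimoduleTensorAlgebra.ofForm k A Γ (C.d (b i))) 0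

/-- The maximal prolongation `Γ^∧` of a first order calculus: the quotient of the tensor algebra
of `Γ` by the two-sided ideal generated by `ProlongationRel`. -/
def MaxProlongation (C : FirstOrderCalculus k A Γ) : Type _ := RingQuot C.ProlongationRel

instance (C : FirstOrderCalculus k A Γ) : Ring C.MaxProlongation :=
  inferInstanceAs (Ring (RingQuot C.ProlongationRel))

instance (C : FirstOrderCalculus k A Γ) : Algebra k C.MaxProlongation :=
  inferInstanceAs (Algebra k (RingQuot C.ProlongationRel))

variable (C : FirstOrderCalculus k A Γ)

/-- The projection from the tensor algebra to the maximal prolongation. -/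
def proj : BimoduleTensorAlgebra k A Γ →ₐ[k] C.MaxProlongation :=
  RingQuot.mkAlgHom k C.ProlongationRel

/-- The inclusion of `A` as the forms of degree 0. -/
def ofAlg : A →ₐ[k] C.MaxProlongation := C.proj.comp (BimoduleTensorAlgebra.ofAlg k A Γ)

/-- The inclusion of `Γ` as the forms of degree 1. -/
def ofForm : Γ →ₗ[k] C.MaxProlongation :=
  C.proj.toLinearMap ∘ₗ BimoduleTensorAlgebra.ofForm k A Γ

/-- The forms of degree `n`: the span of all `a ω₁ ∧ ⋯ ∧ ωₙ` with `a ∈ A` and `ωᵢ ∈ Γ`. -/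
def degree (n : ℕ) : Submodule k C.MaxProlongation :=
  Submodule.span k {x | ∃ (a : A) (ω : Fin n → Γ),
    x = C.ofAlg a * (List.ofFn fun i => C.ofForm (ω i)).prod}

theorem ofForm_smul (a : A) (ω : Γ) : C.ofForm (a • ω) = C.ofAlg a * C.ofForm ω := by
  simp [ofForm, ofAlg, BimoduleTensorAlgebra.ofForm_smul]

theorem ofForm_op_smul (a : A) (ω : Γ) : C.ofForm (ω <• a) = C.ofForm ω * C.ofAlg a := by
  simp [ofForm, ofAlg, BimoduleTensorAlgebra.ofForm_op_smul]

theorem sum_d_mul_d {n : ℕ} {a b : Fin n → A} (h : ∑ i, a i • C.d (b i) = 0) :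
    ∑ i, C.ofForm (C.d (a i)) * C.ofForm (C.d (b i)) = 0 := by
  have := RingQuot.mkAlgHom_rel k (ProlongationRel.mk (C := C) n a b h)
  rw [map_zero] at this
  change C.proj _ = 0 at this
  simpa [ofForm] using this

theorem d_one : C.d 1 = 0 := by
  have h := C.leibniz 1 1
  simpa using h

section lift

variable {E : Type*} [Ring E] [Algebra k E]

/-- The universal property of the maximal prolongation as an algebra. -/
def lift (f : A →ₐ[k] E) (g : Γ →ₗ[k] E) (hl : ∀ a ω, g (a • ω) = f a * g ω)
    (hr : ∀ a ω, g (ω <• a) = g ω * f a)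
    (hd : ∀ (n : ℕ) (a b : Fin n → A), ∑ i, a i • C.d (b i) = 0 →
      ∑ i, g (C.d (a i)) * g (C.d (b i)) = 0) : C.MaxProlongation →ₐ[k] E :=
  RingQuot.liftAlgHom k ⟨BimoduleTensorAlgebra.lift f g hl hr, by
    rintro _ _ ⟨n, a, b, h⟩
    simp [hd n a b h]⟩

variable (f : A →ₐ[k] E) (g : Γ →ₗ[k] E) (hl : ∀ a ω, g (a • ω) = f a * g ω)
    (hr : ∀ a ω, g (ω <• a) = g ω * f a)
    (hd : ∀ (n : ℕ) (a b : Fin n → A), ∑ i, a i • C.d (b i) = 0 →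
      ∑ i, g (C.d (a i)) * g (C.d (b i)) = 0)

theorem lift_proj (x) : C.lift f g hl hr hd (C.proj x) = BimoduleTensorAlgebra.lift f g hl hr x :=
  RingQuot.liftAlgHom_mkAlgHom_apply _ _ _ _

@[simp] theorem lift_ofAlg (a : A) : C.lift f g hl hr hd (C.ofAlg a) = f a := by
  have := C.lift_proj f g hl hr hd (BimoduleTensorAlgebra.ofAlg k A Γ a)
  simpa [ofAlg] using this

@[simp] theorem lift_ofForm (ω : Γ) : C.lift f g hl hr hd (C.ofForm ω) = g ω := by
  have := C.lift_proj f g hl hr hd (BimoduleTensorAlgebra.ofForm k A Γ ω)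
  simpa [ofForm] using this

variable {C} in
theorem hom_ext {φ ψ : C.MaxProlongation →ₐ[k] E}
    (h0 : ∀ a, φ (C.ofAlg a) = ψ (C.ofAlg a))
    (h1 : ∀ ω, φ (C.ofForm ω) = ψ (C.ofForm ω)) : φ = ψ := by
  refine RingQuot.ringQuot_ext' k (A := BimoduleTensorAlgebra k A Γ) φ ψ ?_
  exact BimoduleTensorAlgebra.hom_ext h0 h1

end lift

/-- A subalgebra of the maximal prolongation that contains `A` and `Γ` is everything. -/
theorem eq_top_of_generators (S : Subalgebra k C.MaxProlongation)
    (h0 : ∀ a, C.ofAlg a ∈ S) (h1 : ∀ ω, C.ofForm ω ∈ S) : S = ⊤ := by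
  let φ : C.MaxProlongation →ₐ[k] S := C.lift
    (C.ofAlg.codRestrict S h0) (C.ofForm.codRestrict S.toSubmodule h1)
    (fun a ω => Subtype.ext (C.ofForm_smul a ω)) (fun a ω => Subtype.ext (C.ofForm_op_smul a ω))
    (fun n a b h => Subtype.ext (by
      have := C.sum_d_mul_d h
      rw [ZeroMemClass.coe_zero, ← this]
      exact map_sum S.val _ _))
  have hφ : S.val.comp φ = AlgHom.id k _ := by
    refine hom_ext (fun a => ?_) (fun ω => ?_)
    · simp only [AlgHom.comp_apply, φ, lift_ofAlg]; rfl
    · simp only [AlgHom.comp_apply, φ, lift_ofForm]; rfl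
  refine eq_top_iff.2 fun x _ => ?_
  have := DFunLike.congr_fun hφ x
  rw [← show S.val (φ x) = x from this]
  exact (φ x).2

/-- The grading automorphism `ω ↦ (-1)^|ω| ω`. -/
def sign : C.MaxProlongation →ₐ[k] C.MaxProlongation :=
  C.lift C.ofAlg (-C.ofForm) (fun a ω => by simp [ofForm_smul])
    (fun a ω => by simp [ofForm_op_smul]) (fun n a b h => by simpa using C.sum_d_mul_d h)

@[simp] theorem sign_ofAlg (a : A) : C.sign (C.ofAlg a) = C.ofAlg a := by simp [sign]

@[simp] theorem sign_ofForm (ω : Γ) : C.sign (C.ofForm ω) = -C.ofForm ω := by simp [sign]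

end FirstOrderCalculus

variable [SMulCommClass A Aᵐᵒᵖ Γ] [IsScalarTower k A Γ] [IsScalarTower k Aᵐᵒᵖ Γ]

namespace FirstOrderCalculus

variable (C : FirstOrderCalculus k A Γ)

/-- The surjection `A ⊗ A → Γ`, `a ⊗ b ↦ a d b`. -/
def formMap : A ⊗[k] A →ₗ[k] Γ := TensorProduct.lift ((leftAct k A Γ).compl₂ C.d)

/-- The map `A ⊗ A → Γ^∧`, `a ⊗ b ↦ d a ∧ d b`. -/
def formMap₂ : A ⊗[k] A →ₗ[k] C.MaxProlongation :=
  TensorProduct.lift ((LinearMap.mul k C.MaxProlongation).compl₁₂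
    (C.ofForm ∘ₗ C.d) (C.ofForm ∘ₗ C.d))

@[simp] theorem formMap_tmul (a b : A) : C.formMap (a ⊗ₜ b) = a • C.d b := rfl

@[simp] theorem formMap₂_tmul (a b : A) :
    C.formMap₂ (a ⊗ₜ b) = C.ofForm (C.d a) * C.ofForm (C.d b) := rfl

theorem formMap_surjective : Function.Surjective C.formMap := by
  rw [← LinearMap.range_eq_top, eq_top_iff, ← C.span_eq_top, Submodule.span_le]
  rintro _ ⟨a, b, rfl⟩
  exact ⟨a ⊗ₜ b, rfl⟩

theorem ker_formMap_le : LinearMap.ker C.formMap ≤ LinearMap.ker C.formMap₂ := by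
  intro t ht
  obtain ⟨S, rfl⟩ := TensorProduct.exists_finset t
  rw [LinearMap.mem_ker, map_sum] at ht ⊢
  simp only [formMap_tmul, formMap₂_tmul] at ht ⊢
  rw [← Finset.sum_coe_sort, ← S.equivFin.symm.sum_comp] at ht ⊢
  exact C.sum_d_mul_d (a := fun i => (S.equivFin.symm i).1.1)
    (b := fun i => (S.equivFin.symm i).1.2) ht

/-- The differential on 1-forms, `∑ aᵢ d bᵢ ↦ ∑ d aᵢ ∧ d bᵢ`. -/
def dForm : Γ →ₗ[k] C.MaxProlongation :=
  (LinearMap.ker C.formMap).liftQ C.formMap₂ C.ker_formMap_le ∘ₗ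
    (C.formMap.quotKerEquivOfSurjective C.formMap_surjective).symm.toLinearMap

theorem dForm_formMap (t : A ⊗[k] A) : C.dForm (C.formMap t) = C.formMap₂ t := by
  have h : (C.formMap.quotKerEquivOfSurjective C.formMap_surjective).symm (C.formMap t) =
      (LinearMap.ker C.formMap).mkQ t := by
    rw [LinearEquiv.symm_apply_eq]; rfl
  simp [dForm, h]

theorem dForm_smul_d (a b : A) :
    C.dForm (a • C.d b) = C.ofForm (C.d a) * C.ofForm (C.d b) := C.dForm_formMap (a ⊗ₜ b)

theorem dForm_d (a : A) : C.dForm (C.d a) = 0 := by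
  have := C.dForm_smul_d 1 a
  simpa [C.d_one] using this

theorem form_induction {p : Γ → Prop} (h : ∀ a b : A, p (a • C.d b)) (h0 : p 0)
    (hadd : ∀ x y, p x → p y → p (x + y)) (ω : Γ) : p ω := by
  obtain ⟨t, rfl⟩ := C.formMap_surjective ω
  induction t using TensorProduct.induction_on with
  | zero => simpa using h0
  | tmul a b => exact h a b
  | add x y hx hy => rw [map_add]; exact hadd _ _ hx hy

theorem dForm_smul (a : A) (ω : Γ) :
    C.dForm (a • ω) = C.ofForm (C.d a) * C.ofForm ω + C.ofAlg a * C.dForm ω := by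
  induction ω using C.form_induction with
  | h b c =>
    rw [smul_smul, dForm_smul_d, C.leibniz, dForm_smul_d, map_add, ofForm_op_smul, ofForm_smul,
      ofForm_smul, add_mul, mul_assoc, mul_assoc]
  | h0 => simp
  | hadd x y hx hy => simp only [smul_add, map_add, hx, hy, mul_add]; abel

theorem dForm_op_smul (a : A) (ω : Γ) :
    C.dForm (ω <• a) = C.dForm ω * C.ofAlg a - C.ofForm ω * C.ofForm (C.d a) := by
  induction ω using C.form_induction with
  | h b c =>
    have h : ((b • C.d c) <• a) = b • C.d (c * a) - (b * c) • C.d a := by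
      rw [C.leibniz, smul_add, smul_smul, add_sub_cancel_right, ← smul_comm b]
    rw [h, map_sub, dForm_smul_d, dForm_smul_d, dForm_smul_d, C.leibniz, C.leibniz, map_add,
      map_add, ofForm_op_smul, ofForm_op_smul, ofForm_smul, ofForm_smul]
    noncomm_ring
  | h0 => simp
  | hadd x y hx hy => simp only [smul_add, map_add, hx, hy, add_mul]; abel

/-- The algebra map `ω ↦ ((-1)^|ω| ω, d ω; 0, ω)`: upper triangular matrices turn the graded
Leibniz rule into multiplicativity, so that `d` extends from generators. -/
def dMatrix : C.MaxProlongation →ₐ[k] Matrix (Fin 2) (Fin 2) C.MaxProlongation :=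
  C.lift
    (AlgHom.ofLinearMap
      (upper C.ofAlg.toLinearMap (C.ofForm ∘ₗ C.d) C.ofAlg.toLinearMap)
      (upper_one _ _ _ _ (map_one C.ofAlg) (by simp [C.d_one]) (map_one C.ofAlg))
      (fun a b => upper_mul _ _ _ _ _ _ _ _ _ _ _ _ (map_mul C.ofAlg a b)
        (by simp [C.leibniz, ofForm_smul, ofForm_op_smul, add_comm]) (map_mul C.ofAlg a b)))
    (upper (-C.ofForm) C.dForm C.ofForm)
    (fun a ω => upper_mul _ _ _ _ _ _ _ _ _ _ _ _ (by simp [ofForm_smul])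
      (by simp [dForm_smul, add_comm]) (by simp [ofForm_smul]))
    (fun a ω => upper_mul _ _ _ _ _ _ _ _ _ _ _ _ (by simp [ofForm_op_smul])
      (by simp [dForm_op_smul, sub_eq_neg_add]) (by simp [ofForm_op_smul]))
    (fun n a b h => upper_sum _ _ _ _ _ (by simpa using C.sum_d_mul_d h)
      (by simp [dForm_d]) (C.sum_d_mul_d h))

/-- The differential of the maximal prolongation. -/
def dMax : C.MaxProlongation →ₗ[k] C.MaxProlongation :=
  Matrix.entryLinearMap k C.MaxProlongation 0 1 ∘ₗ C.dMatrix.toLinearMap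

theorem dMatrix_ofAlg (a : A) : C.dMatrix (C.ofAlg a) =
    upper C.ofAlg.toLinearMap (C.ofForm ∘ₗ C.d) C.ofAlg.toLinearMap a :=
  C.lift_ofAlg _ _ _ _ _ a

theorem dMatrix_ofForm (ω : Γ) : C.dMatrix (C.ofForm ω) =
    upper (-C.ofForm) C.dForm C.ofForm ω :=
  C.lift_ofForm _ _ _ _ _ ω

@[simp] theorem dMax_ofAlg (a : A) : C.dMax (C.ofAlg a) = C.ofForm (C.d a) := by
  simp [dMax, dMatrix_ofAlg, upper_apply]

theorem dMax_ofForm (ω : Γ) : C.dMax (C.ofForm ω) = C.dForm ω := by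
  simp [dMax, dMatrix_ofForm, upper_apply]

theorem dMatrix_eq (x : C.MaxProlongation) : C.dMatrix x 0 0 = C.sign x ∧
    C.dMatrix x 1 0 = 0 ∧ C.dMatrix x 1 1 = x := by
  let S : Subalgebra k C.MaxProlongation :=
    { carrier := {x | C.dMatrix x 0 0 = C.sign x ∧ C.dMatrix x 1 0 = 0 ∧ C.dMatrix x 1 1 = x}
      mul_mem' := by
        rintro a b ⟨h1, h2, h3⟩ ⟨h4, h5, h6⟩
        simp [Matrix.mul_apply, h1, h2, h3, h4, h5, h6]
      add_mem' := by
        rintro a b ⟨h1, h2, h3⟩ ⟨h4, h5, h6⟩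
        simp [h1, h2, h3, h4, h5, h6]
      algebraMap_mem' := fun r => by
        simp [Matrix.algebraMap_matrix_apply] }
  have : x ∈ S := by
    rw [C.eq_top_of_generators S (fun a => by simp [S, dMatrix_ofAlg, upper_apply])
      (fun a => by simp [S, dMatrix_ofForm, upper_apply])]
    trivial
  exact this

/-- The graded Leibniz rule. -/
theorem dMax_mul (x y : C.MaxProlongation) :
    C.dMax (x * y) = C.dMax x * y + C.sign x * C.dMax y := by
  have h := C.dMatrix_eq
  change C.dMatrix (x * y) 0 1 = _
  rw [map_mul, Matrix.mul_apply]
  simp only [Fin.sum_univ_two]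
  rw [(h x).1, (h y).2.2, add_comm]
  rfl

end FirstOrderCalculus

end MaximalProlongation

/-! ### Left coinvariant forms -/

namespace LeftCovariantCalculus

open Coalgebra HopfAlgebra

variable {k H Γ : Type*} [Field k] [Ring H] [HopfAlgebra k H] [AddCommGroup Γ] [Module k Γ]
  [Module H Γ] [Module Hᵐᵒᵖ Γ] [SMulCommClass H Hᵐᵒᵖ Γ] [IsScalarTower k H Γ]
  [IsScalarTower k Hᵐᵒᵖ Γ] (C : LeftCovariantCalculus k H Γ)

/-- The coaction on degree 0: `h ↦ h₁ ⊗ h₂`. -/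
def coactAlg : H →ₐ[k] H ⊗[k] C.MaxProlongation :=
  (Algebra.TensorProduct.map (AlgHom.id k H) C.ofAlg).comp (Bialgebra.comulAlgHom k H)

/-- The coaction on degree 1: `ω ↦ ω₋₁ ⊗ ω₀`. -/
def coactForm : Γ →ₗ[k] H ⊗[k] C.MaxProlongation :=
  LinearMap.lTensor H C.ofForm ∘ₗ C.lcoact

theorem coactAlg_apply (h : H) : C.coactAlg h =
    LinearMap.lTensor H C.ofAlg.toLinearMap (comul h) := rfl

theorem lTensor_left (s : H ⊗[k] H) (t : H ⊗[k] Γ) :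
    LinearMap.lTensor H C.ofForm
      (TensorProduct.map₂ (LinearMap.mul k H) (leftAct k H Γ) s t) =
    LinearMap.lTensor H C.ofAlg.toLinearMap s * LinearMap.lTensor H C.ofForm t := by
  induction s using TensorProduct.induction_on with
  | zero => simp
  | add x y hx hy => simp only [map_add, LinearMap.add_apply, hx, hy, add_mul]
  | tmul a b =>
    induction t using TensorProduct.induction_on with
    | zero => simp
    | add x y hx hy => simp only [map_add, hx, hy, mul_add]
    | tmul c ω => simp [TensorProduct.map₂_apply_tmul, leftAct, FirstOrderCalculus.ofForm_smul]

theorem lTensor_right (s : H ⊗[k] H) (t : H ⊗[k] Γ) :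
    LinearMap.lTensor H C.ofForm
      (TensorProduct.map₂ (LinearMap.mul k H) (rightAct k H Γ) t s) =
    LinearMap.lTensor H C.ofForm t * LinearMap.lTensor H C.ofAlg.toLinearMap s := by
  induction t using TensorProduct.induction_on with
  | zero => simp
  | add x y hx hy => simp only [map_add, LinearMap.add_apply, hx, hy, add_mul]
  | tmul a b =>
    induction s using TensorProduct.induction_on with
    | zero => simp
    | add x y hx hy => simp only [map_add, hx, hy, mul_add]
    | tmul c ω => simp [TensorProduct.map₂_apply_tmul, rightAct, FirstOrderCalculus.ofForm_op_smul]

theorem lTensor_d_mul_d (s t : H ⊗[k] H) :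
    LinearMap.lTensor H C.ofForm (LinearMap.lTensor H C.d s) *
      LinearMap.lTensor H C.ofForm (LinearMap.lTensor H C.d t) =
    LinearMap.lTensor H C.dForm (TensorProduct.map₂ (LinearMap.mul k H) (leftAct k H Γ) s
      (LinearMap.lTensor H C.d t)) := by
  induction s using TensorProduct.induction_on with
  | zero => simp
  | add x y hx hy => simp only [map_add, LinearMap.add_apply, hx, hy, add_mul]
  | tmul a b =>
    induction t using TensorProduct.induction_on with
    | zero => simp
    | add x y hx hy => simp only [map_add, hx, hy, mul_add]
    | tmul c ω => simp [TensorProduct.map₂_apply_tmul, leftAct, FirstOrderCalculus.dForm_smul_d]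

theorem lcoact_d_apply (a : H) : C.lcoact (C.d a) = LinearMap.lTensor H C.d (comul a) :=
  DFunLike.congr_fun C.lcoact_d a

theorem coactForm_d_mul (a b : H) : C.coactForm (C.d a) * C.coactForm (C.d b) =
    LinearMap.lTensor H C.dForm (C.lcoact (a • C.d b)) := by
  rw [C.lcoact_smul, lcoact_d_apply, ← lTensor_d_mul_d]
  simp only [coactForm, LinearMap.comp_apply, lcoact_d_apply]

/-- The left coaction `Γ^∧ → H ⊗ Γ^∧`: the algebra map that extends the coactions of `H` on
itself and on `Γ`. -/
def coact : C.MaxProlongation →ₐ[k] H ⊗[k] C.MaxProlongation :=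
  C.lift C.coactAlg C.coactForm
    (fun h ω => by
      rw [coactForm, LinearMap.comp_apply, C.lcoact_smul, lTensor_left, coactAlg_apply]; rfl)
    (fun h ω => by
      rw [coactForm, LinearMap.comp_apply, C.lcoact_op_smul, lTensor_right, coactAlg_apply]; rfl)
    (fun n a b h => by simp only [coactForm_d_mul, ← map_sum, h, map_zero])

@[simp] theorem coact_ofAlg (h : H) : C.coact (C.ofAlg h) = C.coactAlg h :=
  C.lift_ofAlg _ _ _ _ _ h

@[simp] theorem coact_ofForm (ω : Γ) : C.coact (C.ofForm ω) = C.coactForm ω :=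
  C.lift_ofForm _ _ _ _ _ ω

theorem coact_sign (x : C.MaxProlongation) : C.coact (C.sign x) =
    Algebra.TensorProduct.map (AlgHom.id k H) C.sign (C.coact x) := by
  have : C.coact.comp C.sign =
      (Algebra.TensorProduct.map (AlgHom.id k H) C.sign).comp C.coact := by
    refine FirstOrderCalculus.hom_ext (fun h => ?_) (fun ω => ?_)
    · simp only [AlgHom.comp_apply, FirstOrderCalculus.sign_ofAlg, coact_ofAlg, coactAlg_apply]
      induction comul (R := k) h using TensorProduct.induction_on with
      | zero => simp
      | add x y hx hy => rw [map_add, map_add, ← hx, ← hy]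
      | tmul a b => simp
    · simp only [AlgHom.comp_apply, FirstOrderCalculus.sign_ofForm, map_neg, coact_ofForm,
        coactForm, LinearMap.comp_apply]
      induction C.lcoact ω using TensorProduct.induction_on with
      | zero => simp
      | add x y hx hy => rw [map_add, map_add, ← hx, ← hy, neg_add]
      | tmul a b => simp [TensorProduct.tmul_neg]
  exact DFunLike.congr_fun this x

theorem lTensor_dMax_mul (s t : H ⊗[k] C.MaxProlongation) :
    LinearMap.lTensor H C.dMax (s * t) = LinearMap.lTensor H C.dMax s * t +
      Algebra.TensorProduct.map (AlgHom.id k H) C.sign s * LinearMap.lTensor H C.dMax t := by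
  induction s using TensorProduct.induction_on with
  | zero => simp
  | add x y hx hy => simp only [map_add, hx, hy, add_mul]; abel
  | tmul a b =>
    induction t using TensorProduct.induction_on with
    | zero => simp
    | add x y hx hy => simp only [map_add, hx, hy, mul_add]; abel
    | tmul c ω => simp [FirstOrderCalculus.dMax_mul, TensorProduct.tmul_add]

/-- The differential of the maximal prolongation is left colinear. -/
theorem coact_dMax (x : C.MaxProlongation) :
    C.coact (C.dMax x) = LinearMap.lTensor H C.dMax (C.coact x) := by
  have hAlg (h : H) : C.coact (C.dMax (C.ofAlg h)) =
      LinearMap.lTensor H C.dMax (C.coact (C.ofAlg h)) := by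
    simp only [FirstOrderCalculus.dMax_ofAlg, coact_ofAlg, coact_ofForm, coactAlg_apply, coactForm,
      LinearMap.comp_apply, lcoact_d_apply, ← LinearMap.lTensor_comp_apply]
    congr 2
    ext h; simp
  let S : Subalgebra k C.MaxProlongation :=
    { carrier := {x | C.coact (C.dMax x) = LinearMap.lTensor H C.dMax (C.coact x)}
      mul_mem' := by
        intro a b ha hb
        rw [Set.mem_ofPred_eq] at ha hb ⊢
        rw [FirstOrderCalculus.dMax_mul, map_mul, lTensor_dMax_mul, ← ha, ← hb, map_add, map_mul,
          map_mul, coact_sign]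
      add_mem' := by
        intro a b ha hb
        rw [Set.mem_ofPred_eq] at ha hb ⊢
        simp only [map_add, ha, hb]
      algebraMap_mem' := fun r => by
        have := hAlg (algebraMap k H r)
        rwa [AlgHom.commutes] at this }
  have : x ∈ S := by
    rw [C.eq_top_of_generators S hAlg (fun ω => ?_)]
    · trivial
    · change C.coact (C.dMax (C.ofForm ω)) = LinearMap.lTensor H C.dMax (C.coact (C.ofForm ω))
      have hd : C.dMax ∘ₗ C.ofForm = C.dForm := by ext; simp [FirstOrderCalculus.dMax_ofForm]
      rw [FirstOrderCalculus.dMax_ofForm, coact_ofForm, coactForm, LinearMap.comp_apply,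
        ← LinearMap.lTensor_comp_apply, hd]
      induction ω using C.form_induction with
      | h a b => rw [FirstOrderCalculus.dForm_smul_d, map_mul, coact_ofForm, coact_ofForm,
          coactForm_d_mul]
      | h0 => simp
      | hadd x y hx hy => simp only [map_add, hx, hy]
  exact this

/-- The algebra `Λ^•` of left coinvariant forms: those `ω ∈ Γ^∧` with `Δ(ω) = 1 ⊗ ω`. -/
def Coinv : Subalgebra k C.MaxProlongation :=
  AlgHom.equalizer C.coact Algebra.TensorProduct.includeRight

theorem mem_Coinv {x : C.MaxProlongation} : x ∈ C.Coinv ↔ C.coact x = 1 ⊗ₜ x := Iff.rfl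

/-- The left coinvariant forms of degree `n`. -/
def coinvDegree (n : ℕ) : Submodule k C.Coinv :=
  (C.degree n).comap C.Coinv.val.toLinearMap

/-- The differential on left coinvariant forms. -/
def dCoinv : C.Coinv →ₗ[k] C.Coinv :=
  (C.dMax ∘ₗ C.Coinv.val.toLinearMap).codRestrict C.Coinv.toSubmodule fun x => by
    have hx : C.coact (x : C.MaxProlongation) = 1 ⊗ₜ (x : C.MaxProlongation) := x.2
    change C.coact (C.dMax x) = 1 ⊗ₜ (C.dMax x)
    rw [coact_dMax, hx, LinearMap.lTensor_tmul]

/-- The map `h ↦ S(h₁) φ(h₂)` attached to `φ : H → Γ^∧`. -/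
def twist (φ : H →ₗ[k] C.MaxProlongation) : H →ₗ[k] C.MaxProlongation :=
  LinearMap.mul' k C.MaxProlongation ∘ₗ
    TensorProduct.map (C.ofAlg.toLinearMap ∘ₗ antipode k) φ ∘ₗ comul

theorem twist_apply (φ : H →ₗ[k] C.MaxProlongation) (h : H) {ι : Type*}
    (r : Coalgebra.Repr k h ι) : C.twist φ h =
      ∑ i ∈ r.index, C.ofAlg (antipode k (r.left i)) * φ (r.right i) := by
  simp [twist, ← r.eq]

open WithConv in
/-- If `φ` is left colinear, then all `S(h₁) φ(h₂)` are left coinvariant. -/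
theorem twist_mem (φ : H →ₗ[k] C.MaxProlongation)
    (hφ : ∀ h, C.coact (φ h) = LinearMap.lTensor H φ (comul h)) (h : H) :
    C.twist φ h ∈ C.Coinv := by
  let incl : C.MaxProlongation →ₐ[k] H ⊗[k] C.MaxProlongation := Algebra.TensorProduct.includeRight
  let J : WithConv (H →ₗ[k] H ⊗[k] C.MaxProlongation) := toConv ((TensorProduct.mk k H C.MaxProlongation).flip 1)
  have key (ψ : H →ₗ[k] C.MaxProlongation) :
      J * toConv (incl.toLinearMap ∘ₗ ψ) = toConv (LinearMap.lTensor H ψ ∘ₗ comul) := by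
    ext h
    rw [(ℛ k h).convMul_apply]
    simp [J, incl, ← (ℛ k h).eq]
  have inv (f : H →ₐ[k] H ⊗[k] C.MaxProlongation) :
      toConv f.toLinearMap * toConv (f.toLinearMap ∘ₗ antipode k) = 1 := by
    ext h
    rw [(ℛ k h).convMul_apply]
    simp [← map_mul, ← map_sum, sum_mul_antipode_eq_algebraMap_counit (ℛ k h)]
  have inv' (f : H →ₐ[k] H ⊗[k] C.MaxProlongation) :
      toConv (f.toLinearMap ∘ₗ antipode k) * toConv f.toLinearMap = 1 := by
    ext h
    rw [(ℛ k h).convMul_apply]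
    simp [← map_mul, ← map_sum, sum_antipode_mul_eq_algebraMap_counit (ℛ k h)]
  have comp (f : C.MaxProlongation →ₐ[k] H ⊗[k] C.MaxProlongation) :
      toConv (f.toLinearMap ∘ₗ C.twist φ) =
      toConv ((f.comp C.ofAlg).toLinearMap ∘ₗ antipode k) * toConv (f.toLinearMap ∘ₗ φ) := by
    ext h
    rw [(ℛ k h).convMul_apply]
    simp [twist_apply _ _ _ (ℛ k h)]
  have hD : toConv (C.coact.comp C.ofAlg).toLinearMap =
      J * toConv (incl.comp C.ofAlg).toLinearMap := by
    refine Eq.trans ?_ (key C.ofAlg.toLinearMap).symm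
    ext h
    simp [coactAlg_apply]
  have hE : toConv (C.coact.toLinearMap ∘ₗ φ) = J * toConv (incl.toLinearMap ∘ₗ φ) := by
    rw [key]
    ext h
    simp [hφ]
  have hDG : toConv (C.coact.comp C.ofAlg).toLinearMap * toConv (incl.toLinearMap ∘ₗ C.twist φ) =
      toConv (C.coact.toLinearMap ∘ₗ φ) := by
    rw [hD, hE, comp, mul_assoc, ← mul_assoc (toConv (incl.comp C.ofAlg).toLinearMap), inv,
      one_mul]
  have : toConv (C.coact.toLinearMap ∘ₗ C.twist φ) = toConv (incl.toLinearMap ∘ₗ C.twist φ) := by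
    rw [comp, ← hDG, ← mul_assoc, inv', one_mul]
  exact DFunLike.congr_fun (toConv_injective this) h

/-- The right action of `H` on left coinvariant forms, `θ ↼ h = S(h₁) θ h₂`. -/
def hook : C.Coinv →ₗ[k] H →ₗ[k] C.Coinv :=
  LinearMap.mk₂ k (fun θ h => ⟨C.twist (LinearMap.mulLeft k (θ : C.MaxProlongation) ∘ₗ
      C.ofAlg.toLinearMap) h, C.twist_mem _ (fun h => by
        have hθ : C.coact (θ : C.MaxProlongation) = 1 ⊗ₜ (θ : C.MaxProlongation) := θ.2
        simp only [LinearMap.comp_apply, LinearMap.mulLeft_apply, map_mul, hθ,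
          AlgHom.toLinearMap_apply, coact_ofAlg, coactAlg_apply]
        induction comul (R := k) h using TensorProduct.induction_on with
        | zero => simp
        | add x y hx hy => simp only [map_add, mul_add, hx, hy]
        | tmul a b => simp) h⟩)
    (fun θ η h => Subtype.ext <| by
      simp [C.twist_apply _ _ (ℛ k h), add_mul, mul_add, Finset.sum_add_distrib])
    (fun c θ h => Subtype.ext <| by
      simp [C.twist_apply _ _ (ℛ k h), Finset.smul_sum])
    (fun θ h h' => Subtype.ext <| by simp)
    (fun c θ h => Subtype.ext <| by simp)

/-- The projection `π_ε : H → H⁺ = ker ε`, `h ↦ h - ε(h) 1`. -/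
def projAug : H →ₗ[k] LinearMap.ker (counit (R := k) (A := H)) :=
  (LinearMap.id - Algebra.linearMap k H ∘ₗ counit).codRestrict _ fun h => by simp

/-- The quantum Maurer-Cartan form `ϖ : H⁺ → Λ^1`, `h ↦ S(h₁) d h₂`, with values regarded in
`Λ^• ⊇ Λ^1`. -/
def maurerCartan : LinearMap.ker (counit (R := k) (A := H)) →ₗ[k] C.Coinv :=
  ((C.twist (C.ofForm ∘ₗ C.d)) ∘ₗ Submodule.subtype _).codRestrict C.Coinv.toSubmodule
    fun h => C.twist_mem _ (fun h => by
      simp only [LinearMap.comp_apply, coact_ofForm, coactForm, lcoact_d_apply,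
        LinearMap.lTensor_comp]) h

end LeftCovariantCalculus

/-! ### Differential calculi -/

section DifferentialCalculus

variable {k A V : Type*} [Field k] [Ring A] [Algebra k A] [AddCommGroup V] [Module k V]

/-- The graded vector space `V = ⨁ₙ Ω n` with product `wedge`, unit `one` and differential `d`
is a differential `ℕ`-graded algebra. -/
structure IsDGA (Ω : ℕ → Submodule k V) (wedge : V →ₗ[k] V →ₗ[k] V) (one : V)
    (d : V →ₗ[k] V) : Prop where
  isInternal : DirectSum.IsInternal Ω
  wedge_mem : ∀ {m n : ℕ} {x y : V}, x ∈ Ω m → y ∈ Ω n → wedge x y ∈ Ω (m + n)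
  d_mem : ∀ {n : ℕ} {x : V}, x ∈ Ω n → d x ∈ Ω (n + 1)
  wedge_assoc : ∀ x y z : V, wedge (wedge x y) z = wedge x (wedge y z)
  one_wedge : ∀ x : V, wedge one x = x
  wedge_one : ∀ x : V, wedge x one = x
  d_d : ∀ x : V, d (d x) = 0
  leibniz : ∀ {n : ℕ} {x : V} (y : V), x ∈ Ω n →
    d (wedge x y) = wedge (d x) y + (-1 : k) ^ n • wedge x (d y)

/-- A differential calculus on `A`: a differential graded algebra whose degree 0 part is the
algebra `A` (via `incl`) and such that `Ω n` is spanned by the forms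
`a⁰ ∧ d a¹ ∧ ⋯ ∧ d aⁿ`. -/
structure IsDifferentialCalculus (Ω : ℕ → Submodule k V) (wedge : V →ₗ[k] V →ₗ[k] V)
    (d : V →ₗ[k] V) (incl : A →ₗ[k] V) : Prop extends IsDGA Ω wedge (incl 1) d where
  incl_injective : Function.Injective incl
  range_incl : LinearMap.range incl = Ω 0
  incl_mul : ∀ a b : A, incl (a * b) = wedge (incl a) (incl b)
  span_eq : ∀ n : ℕ, Ω n = Submodule.span k {x | ∃ (a₀ : A) (a : Fin n → A),
    x = (List.ofFn a).foldl (fun ω b => wedge ω (d (incl b))) (incl a₀)}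

end DifferentialCalculus

/-! ### Vertical forms -/

section Vertical

variable {k H A Γ : Type*} [Field k] [Ring H] [HopfAlgebra k H] [Ring A] [Algebra k A]
  [AddCommGroup Γ] [Module k Γ] [Module H Γ] [Module Hᵐᵒᵖ Γ] [SMulCommClass H Hᵐᵒᵖ Γ]
  [IsScalarTower k H Γ] [IsScalarTower k Hᵐᵒᵖ Γ]

/-- The space of vertical forms `𝔳𝔢𝔯^•(A) = A ⊗ Λ^•`. -/
abbrev Ver (_P : RightComoduleAlgebra k H A) (C : LeftCovariantCalculus k H Γ) : Type _ :=
  A ⊗[k] C.Coinv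

variable (P : RightComoduleAlgebra k H A) (C : LeftCovariantCalculus k H Γ)

/-- The vertical forms of degree `n`, `𝔳𝔢𝔯^n(A) = A ⊗ Λ^n`. -/
def verDegree (n : ℕ) : Submodule k (Ver P C) :=
  LinearMap.range (LinearMap.lTensor A (C.coinvDegree n).subtype)

/-- The map `b ⊗ η ↦ b₀ ⊗ (b₁ ⊗ η)`. -/
def verCoact : Ver P C →ₗ[k] A ⊗[k] (H ⊗[k] C.Coinv) :=
  (TensorProduct.assoc k A H C.Coinv).toLinearMap ∘ₗ
    LinearMap.rTensor C.Coinv P.coact.toLinearMap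

/-- The bilinear map `(θ, h ⊗ η) ↦ (θ ↼ h) ∧ η`. -/
def hookMul : C.Coinv →ₗ[k] H ⊗[k] C.Coinv →ₗ[k] C.Coinv :=
  TensorProduct.lift.equiv (RingHom.id k) H C.Coinv C.Coinv ∘ₗ
    (LinearMap.llcomp k H C.Coinv (C.Coinv →ₗ[k] C.Coinv) (LinearMap.mul k C.Coinv)) ∘ₗ C.hook

/-- The wedge product of vertical forms, `(a ⊗ θ) ∧ (b ⊗ η) = a b₀ ⊗ (θ ↼ b₁) ∧ η`. -/
def verWedge : Ver P C →ₗ[k] Ver P C →ₗ[k] Ver P C :=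
  (TensorProduct.map₂ (LinearMap.mul k A) (hookMul C)).compl₂ (verCoact P C)

/-- The differential of vertical forms, `d(a ⊗ θ) = a ⊗ dθ + a₀ ⊗ ϖ(π_ε(a₁)) ∧ θ`. -/
def verD : Ver P C →ₗ[k] Ver P C :=
  LinearMap.lTensor A C.dCoinv +
    LinearMap.lTensor A (LinearMap.mul' k C.Coinv ∘ₗ
      LinearMap.rTensor C.Coinv (C.maurerCartan ∘ₗ LeftCovariantCalculus.projAug)) ∘ₗ
        verCoact P C

/-- The inclusion `A → 𝔳𝔢𝔯^0(A)`, `a ↦ a ⊗ 1`. -/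
def verIncl : A →ₗ[k] Ver P C := (TensorProduct.mk k A C.Coinv).flip 1

end Vertical

end QPB

end

open scoped TensorProduct RightActions

set_option linter.unusedSectionVars false

noncomputable section

namespace QPB

/-! ### Gradings obtained from projections. -/

section Graded

variable {k V : Type*} [Field k] [AddCommGroup V] [Module k V]

/-! The algebraic laws are not checked on the twisted formulas. The vertical forms embed into the
ordinary tensor product algebra `A ⊗ Γ^∧` by `a ⊗ θ ↦ a₀ ⊗ a₁θ` (`verEmbed`). The map `a ⊗ ω ↦ a₀ ⊗
S(a₁)ω` undoes it, so it is injective. Since `h₁S(h₂)φ(h₃) = φ(h)` for every linear `φ : H → Γ^∧`,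
the embedding turns the wedge product into the plain product (take `φ(h) = θh`) and the differential
into `id ⊗ d` (take `φ = d`). Associativity, unit, `d² = 0` and the Leibniz rule are then inherited
from `A ⊗ Γ^∧`.

The grading comes from `Γ^∧`, whose homogeneous components are the coefficients of an algebra map
`Γ^∧ → Γ^∧[X]`. The coaction commutes with taking components, so `Λ` and `A ⊗ Λ` are graded as well.
In degree 0, `Δ(h) = 1 ⊗ h` forces `h = ε(h)1`, whence `Λ⁰ = k` and `𝔳𝔢𝔯⁰(A) = A`.

Two facts give the spanning property. First, `Λ` is generated by Maurer-Cartan forms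
(`coinvDegree_eq`): `dh = h₁ϖ(π_ε(h₂))` lets every form be written as coefficients on the left times
products of values of `ϖ`, and `ω ↦ S(ω₋₁)ω₀` reduces the coefficients to scalars while fixing
coinvariant forms. Second, `a ∧ db` is the image of `χ(a ⊗ b)` under `id ⊗ ϖπ_ε`, so surjectivity of
`χ` yields all of `A ⊗ Λ¹`. An induction that splits off the last Maurer-Cartan factor reaches every
degree. -/

/-- Submodules that admit complementary projections and span the space form a grading. -/
theorem isInternal_of_projections (Ω : ℕ → Submodule k V) (p : ℕ → V →ₗ[k] V)
    (hid : ∀ n, ∀ x ∈ Ω n, p n x = x) (hzero : ∀ m n, m ≠ n → ∀ x ∈ Ω n, p m x = 0)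
    (htop : iSup Ω = ⊤) : DirectSum.IsInternal Ω := by
  refine DirectSum.isInternal_submodule_of_iSupIndep_of_iSup_eq_top ?_ htop
  intro n
  rw [Submodule.disjoint_def]
  intro x hx hx'
  have h : (⨆ (j) (_ : j ≠ n), Ω j) ≤ LinearMap.ker (p n) :=
    iSup₂_le fun j hj y hy => hzero n j hj.symm y hy
  rw [← hid n x hx]
  exact h hx'

end Graded

namespace FirstOrderCalculus

variable {k A Γ : Type*} [Field k] [Ring A] [Algebra k A] [AddCommGroup Γ] [Module k Γ]
  [Module A Γ] [Module Aᵐᵒᵖ Γ] (C : FirstOrderCalculus k A Γ)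

/-! ### The grading of the maximal prolongation -/

theorem ofAlg_mem_degree (a : A) : C.ofAlg a ∈ C.degree 0 :=
  Submodule.subset_span ⟨a, Fin.elim0, by simp⟩

theorem degree_mul_ofForm {n : ℕ} {x : C.MaxProlongation} (hx : x ∈ C.degree n) (ω : Γ) :
    x * C.ofForm ω ∈ C.degree (n + 1) := by
  refine Submodule.span_induction (p := fun x _ => x * C.ofForm ω ∈ C.degree (n + 1))
    ?_ (by simp) (fun x y _ _ hx hy => by rw [add_mul]; exact add_mem hx hy)
    (fun c x _ hx => by rw [smul_mul_assoc]; exact Submodule.smul_mem _ c hx) hx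
  rintro _ ⟨a, η, rfl⟩
  refine Submodule.subset_span ⟨a, Fin.snoc η ω, ?_⟩
  rw [List.ofFn_succ', List.concat_eq_append, List.prod_append]
  simp [mul_assoc]

theorem degree_zero : C.degree 0 = LinearMap.range C.ofAlg.toLinearMap := by
  refine le_antisymm (Submodule.span_le.2 ?_) ?_
  · rintro _ ⟨a, η, rfl⟩
    exact ⟨a, by simp⟩
  · rintro _ ⟨a, rfl⟩
    exact C.ofAlg_mem_degree a

/-- Splitting off the last 1-form; this is the recursion behind the inductions on the degree below.
-/
theorem degree_succ (n : ℕ) : C.degree (n + 1) = C.degree n * LinearMap.range C.ofForm := by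
  refine le_antisymm (Submodule.span_le.2 ?_) (Submodule.mul_le.2 ?_)
  · rintro _ ⟨a, η, rfl⟩
    rw [List.ofFn_succ', List.concat_eq_append, List.prod_append, ← mul_assoc]
    refine Submodule.mul_mem_mul (Submodule.subset_span ⟨a, _, rfl⟩) ⟨η (Fin.last n), by simp⟩
  · rintro x hx _ ⟨ω, rfl⟩
    exact C.degree_mul_ofForm hx ω

theorem range_ofForm_mul_range_ofAlg :
    LinearMap.range C.ofForm * LinearMap.range C.ofAlg.toLinearMap ≤ LinearMap.range C.ofForm := by
  refine Submodule.mul_le.2 ?_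
  rintro _ ⟨ω, rfl⟩ _ ⟨a, rfl⟩
  exact ⟨ω <• a, C.ofForm_op_smul a ω⟩

theorem range_ofAlg_mul_range_ofAlg :
    LinearMap.range C.ofAlg.toLinearMap * LinearMap.range C.ofAlg.toLinearMap ≤
      LinearMap.range C.ofAlg.toLinearMap := by
  refine Submodule.mul_le.2 ?_
  rintro _ ⟨a, rfl⟩ _ ⟨b, rfl⟩
  exact ⟨a * b, map_mul C.ofAlg a b⟩

theorem degree_mul_degree_zero (n : ℕ) : C.degree n * C.degree 0 ≤ C.degree n := by
  cases n with
  | zero =>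
    rw [degree_zero]
    exact C.range_ofAlg_mul_range_ofAlg
  | succ n =>
    rw [degree_succ, degree_zero, mul_assoc]
    exact mul_le_mul' le_rfl C.range_ofForm_mul_range_ofAlg

theorem degree_mul_degree (m n : ℕ) : C.degree m * C.degree n ≤ C.degree (m + n) := by
  induction n with
  | zero => exact C.degree_mul_degree_zero m
  | succ n ih =>
    rw [degree_succ, ← mul_assoc, ← add_assoc, degree_succ]
    exact mul_le_mul' ih le_rfl

theorem mul_mem_degree {m n l : ℕ} (h : m + n = l) {x y : C.MaxProlongation}
    (hx : x ∈ C.degree m) (hy : y ∈ C.degree n) : x * y ∈ C.degree l :=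
  h ▸ C.degree_mul_degree m n (Submodule.mul_mem_mul hx hy)

theorem ofForm_mem_degree (ω : Γ) : C.ofForm ω ∈ C.degree 1 := by
  simpa using C.degree_mul_ofForm (C.ofAlg_mem_degree 1) ω

theorem one_mem_degree : (1 : C.MaxProlongation) ∈ C.degree 0 := by
  simpa using C.ofAlg_mem_degree 1

/-- The algebra map `x ↦ ∑ₙ xₙ Xⁿ`, where `xₙ` is the component of degree `n` of `x`. -/
def gradingMap : C.MaxProlongation →ₐ[k] Polynomial C.MaxProlongation :=
  C.lift (Polynomial.CAlgHom.comp C.ofAlg)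
    ((Polynomial.monomial 1).restrictScalars k ∘ₗ C.ofForm)
    (fun a ω => by simp [ofForm_smul, Polynomial.C_mul_monomial])
    (fun a ω => by simp [ofForm_op_smul, Polynomial.monomial_mul_C])
    -- The relations are homogeneous of degree 2: their image is `X²` times a relation that already
    -- holds in `Γ^∧`.
    (fun n a b h => by
      simp only [LinearMap.comp_apply, LinearMap.restrictScalars_apply,
        Polynomial.monomial_mul_monomial, ← map_sum, C.sum_d_mul_d h, map_zero])

@[simp] theorem gradingMap_ofAlg (a : A) : C.gradingMap (C.ofAlg a) = Polynomial.C (C.ofAlg a) :=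
  C.lift_ofAlg _ _ _ _ _ a

@[simp] theorem gradingMap_ofForm (ω : Γ) :
    C.gradingMap (C.ofForm ω) = Polynomial.monomial 1 (C.ofForm ω) :=
  C.lift_ofForm _ _ _ _ _ ω

/-- The projection to the component of degree `n`. -/
def component (n : ℕ) : C.MaxProlongation →ₗ[k] C.MaxProlongation :=
  (Polynomial.lcoeff C.MaxProlongation n).restrictScalars k ∘ₗ C.gradingMap.toLinearMap

theorem component_apply (n : ℕ) (x : C.MaxProlongation) :
    C.component n x = (C.gradingMap x).coeff n := rfl

theorem component_mul (n : ℕ) (x y : C.MaxProlongation) : C.component n (x * y) =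
    ∑ p ∈ Finset.HasAntidiagonal.antidiagonal n, C.component p.1 x * C.component p.2 y := by
  simp only [component_apply, map_mul, Polynomial.coeff_mul]

theorem gradingMap_of_mem {n : ℕ} {x : C.MaxProlongation} (hx : x ∈ C.degree n) :
    C.gradingMap x = Polynomial.monomial n x := by
  induction n generalizing x with
  | zero =>
    rw [degree_zero] at hx
    obtain ⟨a, rfl⟩ := hx
    simp
  | succ n ih =>
    rw [degree_succ] at hx
    refine Submodule.mul_induction_on hx ?_ (fun x y hx hy => by rw [map_add, map_add, hx, hy])
    rintro x hx _ ⟨ω, rfl⟩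
    rw [map_mul, ih hx, gradingMap_ofForm, Polynomial.monomial_mul_monomial]

theorem component_of_mem {n : ℕ} {x : C.MaxProlongation} (hx : x ∈ C.degree n) :
    C.component n x = x := by
  rw [component_apply, C.gradingMap_of_mem hx, Polynomial.coeff_monomial_same]

theorem component_of_mem_of_ne {m n : ℕ} (h : m ≠ n) {x : C.MaxProlongation}
    (hx : x ∈ C.degree n) : C.component m x = 0 := by
  rw [component_apply, C.gradingMap_of_mem hx, Polynomial.coeff_monomial_of_ne _ h]

/-- The sum of the degrees is closed under products and contains the generators `A` and `Γ`. -/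
theorem iSup_degree : ⨆ n, C.degree n = ⊤ := by
  let S : Subalgebra k C.MaxProlongation :=
    { carrier := (⨆ n, C.degree n : Submodule k C.MaxProlongation)
      mul_mem' := by
        intro x y hx hy
        have h : (⨆ n, C.degree n) * (⨆ n, C.degree n) ≤ ⨆ n, C.degree n := by
          rw [Submodule.iSup_mul]
          refine iSup_le fun m => ?_
          rw [Submodule.mul_iSup]
          exact iSup_le fun n => (C.degree_mul_degree m n).trans (le_iSup C.degree (m + n))
        exact h (Submodule.mul_mem_mul hx hy)
      add_mem' := fun hx hy => add_mem hx hy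
      algebraMap_mem' := fun r => by
        rw [← AlgHom.commutes C.ofAlg]
        exact Submodule.mem_iSup_of_mem 0 (C.ofAlg_mem_degree _) }
  have hS := C.eq_top_of_generators S
    (fun a => Submodule.mem_iSup_of_mem 0 (C.ofAlg_mem_degree a))
    (fun ω => Submodule.mem_iSup_of_mem 1 (C.ofForm_mem_degree ω))
  refine eq_top_iff.2 fun x _ => ?_
  have : x ∈ S := hS ▸ Algebra.mem_top
  exact this

/-- A linear identity on the maximal prolongation may be checked on homogeneous elements. -/
theorem degree_induction {p : C.MaxProlongation → Prop} (h : ∀ n, ∀ x ∈ C.degree n, p x)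
    (hadd : ∀ x y, p x → p y → p (x + y)) (x : C.MaxProlongation) : p x :=
  Submodule.iSup_induction C.degree (motive := p) (by rw [iSup_degree]; trivial) h
    (h 0 0 (zero_mem _)) hadd

theorem component_mem (n : ℕ) (x : C.MaxProlongation) : C.component n x ∈ C.degree n := by
  induction x using C.degree_induction with
  | h m x hx =>
    obtain rfl | hmn := eq_or_ne n m
    · rwa [C.component_of_mem hx]
    · rw [C.component_of_mem_of_ne hmn hx]
      exact zero_mem _
  | hadd x y hx hy => rw [map_add]; exact add_mem hx hy

theorem sum_component (x : C.MaxProlongation) :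
    ∃ N, ∑ n ∈ Finset.range N, C.component n x = x := by
  -- Putting `X = 1` in `∑ xₙXⁿ` recovers `x`, and a polynomial has finitely many coefficients.
  have hg : Polynomial.eval 1 (C.gradingMap x) = x := by
    induction x using C.degree_induction with
    | h n x hx => rw [C.gradingMap_of_mem hx]; simp
    | hadd x y hx hy => rw [map_add, Polynomial.eval_add, hx, hy]
  refine ⟨(C.gradingMap x).natDegree + 1, ?_⟩
  rw [Polynomial.eval_eq_sum_range] at hg
  simpa [component_apply] using hg

/-- Converts the Leibniz rule of `dMax_mul`, stated with the automorphism `sign`, into the one with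
explicit signs. -/
theorem sign_of_mem {n : ℕ} {x : C.MaxProlongation} (hx : x ∈ C.degree n) :
    C.sign x = (-1 : k) ^ n • x := by
  induction n generalizing x with
  | zero =>
    rw [degree_zero] at hx
    obtain ⟨a, rfl⟩ := hx
    simp
  | succ n ih =>
    rw [degree_succ] at hx
    refine Submodule.mul_induction_on hx ?_
      (fun x y hx hy => by rw [map_add, smul_add, hx, hy])
    rintro x hx _ ⟨ω, rfl⟩
    rw [map_mul, ih hx, sign_ofForm, pow_succ]
    simp

/-- The augmentation of the maximal prolongation onto the forms of degree 0. -/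
def toAlg : C.MaxProlongation →ₐ[k] A :=
  C.lift (AlgHom.id k A) 0 (by simp) (by simp) (by simp)

@[simp] theorem toAlg_ofAlg (a : A) : C.toAlg (C.ofAlg a) = a := C.lift_ofAlg _ _ _ _ _ a

/-! ### The differential of the maximal prolongation -/

variable [SMulCommClass A Aᵐᵒᵖ Γ] [IsScalarTower k A Γ] [IsScalarTower k Aᵐᵒᵖ Γ]

theorem dForm_mem_degree (ω : Γ) : C.dForm ω ∈ C.degree 2 := by
  induction ω using C.form_induction with
  | h a b =>
    rw [dForm_smul_d]
    exact C.mul_mem_degree one_add_one_eq_two (C.ofForm_mem_degree (C.d a))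
      (C.ofForm_mem_degree (C.d b))
  | h0 => rw [map_zero]; exact zero_mem _
  | hadd x y hx hy => rw [map_add]; exact add_mem hx hy

theorem dMax_mem_degree {n : ℕ} {x : C.MaxProlongation} (hx : x ∈ C.degree n) :
    C.dMax x ∈ C.degree (n + 1) := by
  induction n generalizing x with
  | zero =>
    rw [degree_zero] at hx
    obtain ⟨a, rfl⟩ := hx
    simpa using C.ofForm_mem_degree (C.d a)
  | succ n ih =>
    rw [degree_succ] at hx
    refine Submodule.mul_induction_on hx ?_
      (fun x y hx hy => by rw [map_add]; exact add_mem hx hy)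
    rintro x hx _ ⟨ω, rfl⟩
    rw [dMax_mul, C.sign_of_mem hx, dMax_ofForm, smul_mul_assoc]
    exact add_mem (C.degree_mul_ofForm (ih hx) ω)
      (Submodule.smul_mem _ _ (C.mul_mem_degree (by omega) hx (C.dForm_mem_degree ω)))

theorem dMax_mul_of_mem {n : ℕ} {x : C.MaxProlongation} (hx : x ∈ C.degree n)
    (y : C.MaxProlongation) : C.dMax (x * y) = C.dMax x * y + (-1 : k) ^ n • (x * C.dMax y) := by
  rw [dMax_mul, C.sign_of_mem hx, smul_mul_assoc]

theorem dMax_dForm (ω : Γ) : C.dMax (C.dForm ω) = 0 := by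
  induction ω using C.form_induction with
  | h a b => rw [dForm_smul_d, dMax_mul, dMax_ofForm, dMax_ofForm, dForm_d, dForm_d]; simp
  | h0 => simp
  | hadd x y hx hy => rw [map_add, map_add, hx, hy, add_zero]

/-- The differential of the maximal prolongation squares to zero. -/
theorem dMax_dMax (x : C.MaxProlongation) : C.dMax (C.dMax x) = 0 := by
  induction x using C.degree_induction with
  | h n x hx =>
    induction n generalizing x with
    | zero =>
      rw [degree_zero] at hx
      obtain ⟨a, rfl⟩ := hx
      simp [dMax_ofForm, dForm_d]
    | succ n ih =>
      rw [degree_succ] at hx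
      refine Submodule.mul_induction_on hx ?_
        (fun x y hx hy => by rw [map_add, map_add, hx, hy, add_zero])
      rintro x hx _ ⟨ω, rfl⟩
      -- In `d(dx ω + (-1)ⁿ x dω)` the two copies of `dx dω` carry the signs `(-1)ⁿ⁺¹` and `(-1)ⁿ`
      -- and cancel.
      rw [C.dMax_mul_of_mem hx, map_add, map_smul, C.dMax_mul_of_mem (C.dMax_mem_degree hx),
        C.dMax_mul_of_mem hx, ih x hx, dMax_ofForm, dMax_dForm, pow_succ]
      simp
  | hadd x y hx hy => rw [map_add, map_add, hx, hy, add_zero]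

end FirstOrderCalculus

namespace LeftCovariantCalculus

open Coalgebra HopfAlgebra

variable {k H Γ : Type*} [Field k] [Ring H] [HopfAlgebra k H] [AddCommGroup Γ] [Module k Γ]
  [Module H Γ] [Module Hᵐᵒᵖ Γ] [SMulCommClass H Hᵐᵒᵖ Γ] [IsScalarTower k H Γ]
  [IsScalarTower k Hᵐᵒᵖ Γ] (C : LeftCovariantCalculus k H Γ)

/-! ### The grading of the coinvariant forms -/

theorem lTensor_component_mul (n : ℕ) (s t : H ⊗[k] C.MaxProlongation) :
    LinearMap.lTensor H (C.component n) (s * t) = ∑ p ∈ Finset.HasAntidiagonal.antidiagonal n,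
      LinearMap.lTensor H (C.component p.1) s * LinearMap.lTensor H (C.component p.2) t := by
  induction s using TensorProduct.induction_on with
  | zero => simp
  | add x y hx hy => simp only [map_add, hx, hy, add_mul, Finset.sum_add_distrib]
  | tmul a b =>
    induction t using TensorProduct.induction_on with
    | zero => simp
    | add x y hx hy => simp only [map_add, hx, hy, mul_add, Finset.sum_add_distrib]
    | tmul c ω => simp [FirstOrderCalculus.component_mul, TensorProduct.tmul_sum]

/-- The left coaction has degree 0. -/
theorem coact_component (x : C.MaxProlongation) (n : ℕ) :
    C.coact (C.component n x) = LinearMap.lTensor H (C.component n) (C.coact x) := by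
  have hAlg (h : H) (n : ℕ) : C.coact (C.component n (C.ofAlg h)) =
      LinearMap.lTensor H (C.component n) (C.coact (C.ofAlg h)) := by
    rw [coact_ofAlg, coactAlg_apply, ← LinearMap.lTensor_comp_apply]
    obtain rfl | hn := eq_or_ne n 0
    · have hc : C.component 0 ∘ₗ C.ofAlg.toLinearMap = C.ofAlg.toLinearMap :=
        LinearMap.ext fun g => C.component_of_mem (C.ofAlg_mem_degree g)
      rw [C.component_of_mem (C.ofAlg_mem_degree h), coact_ofAlg, coactAlg_apply, hc]
    · have hc : C.component n ∘ₗ C.ofAlg.toLinearMap = 0 :=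
        LinearMap.ext fun g => C.component_of_mem_of_ne hn (C.ofAlg_mem_degree g)
      rw [C.component_of_mem_of_ne hn (C.ofAlg_mem_degree h), hc]
      simp
  have hForm (ω : Γ) (n : ℕ) : C.coact (C.component n (C.ofForm ω)) =
      LinearMap.lTensor H (C.component n) (C.coact (C.ofForm ω)) := by
    rw [coact_ofForm, coactForm, LinearMap.comp_apply, ← LinearMap.lTensor_comp_apply]
    obtain rfl | hn := eq_or_ne n 1
    · have hc : C.component 1 ∘ₗ C.ofForm = C.ofForm :=
        LinearMap.ext fun g => C.component_of_mem (C.ofForm_mem_degree g)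
      rw [C.component_of_mem (C.ofForm_mem_degree ω), coact_ofForm, coactForm, hc]
      rfl
    · have hc : C.component n ∘ₗ C.ofForm = 0 :=
        LinearMap.ext fun g => C.component_of_mem_of_ne hn (C.ofForm_mem_degree g)
      rw [C.component_of_mem_of_ne hn (C.ofForm_mem_degree ω), hc]
      simp
  -- All `n` are required at once, because a component of a product involves components of several
  -- degrees of its factors.
  let S : Subalgebra k C.MaxProlongation :=
    { carrier := {x | ∀ n, C.coact (C.component n x) =
        LinearMap.lTensor H (C.component n) (C.coact x)}
      mul_mem' := by
        intro a b ha hb n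
        rw [FirstOrderCalculus.component_mul, map_mul, lTensor_component_mul, map_sum]
        exact Finset.sum_congr rfl fun p _ => by rw [map_mul, ha, hb]
      add_mem' := by
        intro a b ha hb n
        rw [map_add, map_add, ha, hb, map_add, map_add]
      algebraMap_mem' := fun r => by
        have := hAlg (algebraMap k H r)
        rwa [AlgHom.commutes] at this }
  have : x ∈ S := by
    rw [C.eq_top_of_generators S hAlg hForm]
    trivial
  exact this n

/-- The projection of a coinvariant form to its component of degree `n`. -/
def coinvComponent (n : ℕ) : C.Coinv →ₗ[k] C.Coinv :=
  (C.component n ∘ₗ C.Coinv.val.toLinearMap).codRestrict C.Coinv.toSubmodule fun x => by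
    have hx : C.coact (x : C.MaxProlongation) = 1 ⊗ₜ (x : C.MaxProlongation) := x.2
    change C.coact (C.component n x) = 1 ⊗ₜ (C.component n x)
    rw [coact_component, hx, LinearMap.lTensor_tmul]

theorem mem_coinvDegree {n : ℕ} {θ : C.Coinv} :
    θ ∈ C.coinvDegree n ↔ (θ : C.MaxProlongation) ∈ C.degree n := Iff.rfl

theorem coinvComponent_of_mem {n : ℕ} {θ : C.Coinv} (hθ : θ ∈ C.coinvDegree n) :
    C.coinvComponent n θ = θ := Subtype.ext (C.component_of_mem hθ)

theorem coinvComponent_of_mem_of_ne {m n : ℕ} (h : m ≠ n) {θ : C.Coinv}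
    (hθ : θ ∈ C.coinvDegree n) : C.coinvComponent m θ = 0 :=
  Subtype.ext (C.component_of_mem_of_ne h hθ)

/-- The components of a coinvariant form are again coinvariant, so the decomposition in `Γ^∧` takes
place inside `Λ`. -/
theorem iSup_coinvDegree : ⨆ n, C.coinvDegree n = ⊤ := by
  refine eq_top_iff.2 fun θ _ => ?_
  obtain ⟨N, hN⟩ := C.sum_component (θ : C.MaxProlongation)
  have h : ∑ n ∈ Finset.range N, C.coinvComponent n θ = θ := by
    refine Subtype.ext (Eq.trans ?_ hN)
    exact map_sum C.Coinv.val _ _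
  rw [← h]
  exact sum_mem fun n _ => Submodule.mem_iSup_of_mem n (C.component_mem n θ)

theorem coinv_mul_mem {m n l : ℕ} (h : m + n = l) {θ η : C.Coinv} (hθ : θ ∈ C.coinvDegree m)
    (hη : η ∈ C.coinvDegree n) : θ * η ∈ C.coinvDegree l :=
  C.mul_mem_degree h hθ hη

theorem dCoinv_mem {n : ℕ} {θ : C.Coinv} (hθ : θ ∈ C.coinvDegree n) :
    C.dCoinv θ ∈ C.coinvDegree (n + 1) := C.dMax_mem_degree hθ

theorem one_mem_coinvDegree : (1 : C.Coinv) ∈ C.coinvDegree 0 := C.one_mem_degree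

theorem coinvDegree_zero : C.coinvDegree 0 = Submodule.span k {1} := by
  refine le_antisymm (fun θ hθ => ?_) ?_
  · rw [mem_coinvDegree, FirstOrderCalculus.degree_zero] at hθ
    obtain ⟨h, hh⟩ := hθ
    have hθ : C.coact (θ : C.MaxProlongation) = 1 ⊗ₜ (θ : C.MaxProlongation) := θ.2
    have hc : LinearMap.lTensor H C.toAlg.toLinearMap ∘ₗ
        LinearMap.lTensor H C.ofAlg.toLinearMap = LinearMap.id := by
      ext; simp
    -- `toAlg` is a left inverse of `ofAlg`, so this brings coinvariance back to `Δ(h) = 1 ⊗ h` in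
    -- `H ⊗ H`; then `id ⊗ ε` gives `h = ε(h)1`.
    have h1 := congrArg (LinearMap.lTensor H C.toAlg.toLinearMap) hθ
    rw [← hh, AlgHom.toLinearMap_apply, coact_ofAlg, coactAlg_apply, ← LinearMap.comp_apply, hc,
      LinearMap.id_apply, LinearMap.lTensor_tmul, AlgHom.toLinearMap_apply,
      FirstOrderCalculus.toAlg_ofAlg] at h1
    have h2 : h = counit (R := k) h • (1 : H) := by
      have h3 := congrArg (TensorProduct.rid k H ∘ LinearMap.lTensor H (counit (R := k))) h1
      simpa [Coalgebra.lTensor_counit_comul] using h3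
    refine Submodule.mem_span_singleton.2 ⟨counit (R := k) h, Subtype.ext ?_⟩
    rw [← hh, h2]
    simp
  · rw [Submodule.span_singleton_le_iff_mem]
    exact C.one_mem_coinvDegree

/-! ### Convolution identities -/

open WithConv

theorem toConv_twist (φ : H →ₗ[k] C.MaxProlongation) : toConv (C.twist φ) =
    toConv (C.ofAlg.toLinearMap ∘ₗ antipode k) * toConv φ := rfl

theorem toConv_antipode_mul : toConv (C.ofAlg.toLinearMap ∘ₗ antipode k) *
    toConv C.ofAlg.toLinearMap = 1 := by
  ext h
  rw [(ℛ k h).convMul_apply]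
  simp [← map_mul, ← map_sum, sum_antipode_mul_eq_algebraMap_counit (ℛ k h)]

theorem toConv_mul_antipode : toConv C.ofAlg.toLinearMap *
    toConv (C.ofAlg.toLinearMap ∘ₗ antipode k) = 1 := by
  ext h
  rw [(ℛ k h).convMul_apply]
  simp [← map_mul, ← map_sum, sum_mul_antipode_eq_algebraMap_counit (ℛ k h)]

/-- The inclusion of `H` has the convolution inverse `ofAlg ∘ S`, so `twist` can be undone. Both
compatibilities of `verEmbed` and the generation of `Λ` rest on this. -/
theorem toConv_mul_twist (φ : H →ₗ[k] C.MaxProlongation) :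
    toConv C.ofAlg.toLinearMap * toConv (C.twist φ) = toConv φ := by
  rw [toConv_twist, ← mul_assoc, toConv_mul_antipode, one_mul]

/-! ### Generation of the coinvariant forms in degree one -/

theorem twist_mem_degree {n : ℕ} (φ : H →ₗ[k] C.MaxProlongation)
    (hφ : ∀ h, φ h ∈ C.degree n) (h : H) : C.twist φ h ∈ C.degree n := by
  rw [C.twist_apply φ h (ℛ k h)]
  exact sum_mem fun i _ => C.mul_mem_degree (zero_add n) (C.ofAlg_mem_degree _) (hφ _)

theorem coe_hook (θ : C.Coinv) (h : H) : (C.hook θ h : C.MaxProlongation) =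
    C.twist (LinearMap.mulLeft k (θ : C.MaxProlongation) ∘ₗ C.ofAlg.toLinearMap) h := rfl

theorem hook_mem {n : ℕ} {θ : C.Coinv} (hθ : θ ∈ C.coinvDegree n) (h : H) :
    C.hook θ h ∈ C.coinvDegree n :=
  C.twist_mem_degree _ (fun g => C.mul_mem_degree (add_zero n) hθ (C.ofAlg_mem_degree g)) h

/-- The Maurer-Cartan form precomposed with the projection `H → H⁺`. -/
abbrev maurerCartanProj : H →ₗ[k] C.Coinv := C.maurerCartan ∘ₗ projAug

/-- The projection to `H⁺` has no effect here because `d1 = 0`. -/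
theorem coe_maurerCartanProj (h : H) : (C.maurerCartanProj h : C.MaxProlongation) =
    C.twist (C.ofForm ∘ₗ C.d) h := by
  change C.twist (C.ofForm ∘ₗ C.d) (h - algebraMap k H (counit h)) = _
  rw [map_sub, sub_eq_self, Algebra.algebraMap_eq_smul_one, map_smul]
  simp [twist, Bialgebra.comul_one, Algebra.TensorProduct.one_def, C.d_one]

theorem maurerCartanProj_mem (h : H) : C.maurerCartanProj h ∈ C.coinvDegree 1 := by
  rw [mem_coinvDegree, coe_maurerCartanProj]
  exact C.twist_mem_degree _ (fun g => C.ofForm_mem_degree _) h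

/-- The space of all `S(h₁) d h₂` in the maximal prolongation. -/
def invForms : Submodule k C.MaxProlongation := LinearMap.range (C.twist (C.ofForm ∘ₗ C.d))

theorem map_range_maurerCartanProj :
    (LinearMap.range C.maurerCartanProj).map C.Coinv.val.toLinearMap = C.invForms := by
  rw [invForms, ← LinearMap.range_comp]
  congr 1
  ext h
  exact C.coe_maurerCartanProj h

theorem invForms_le : C.invForms ≤ LinearMap.range C.ofForm := by
  rintro _ ⟨h, rfl⟩
  rw [C.twist_apply _ h (ℛ k h)]
  exact sum_mem fun i _ => ⟨_, C.ofForm_smul _ _⟩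

/-- `db = b₁ · S(b₂) db₃` by `toConv_mul_twist`, and the forms `a db` span `Γ`. -/
theorem range_ofForm_le :
    LinearMap.range C.ofForm ≤ LinearMap.range C.ofAlg.toLinearMap * C.invForms := by
  rintro _ ⟨ω, rfl⟩
  induction ω using C.form_induction with
  | h a b =>
    have hb : C.ofForm (C.d b) ∈ LinearMap.range C.ofAlg.toLinearMap * C.invForms := by
      have := congrArg (fun f => f.ofConv b) (C.toConv_mul_twist (C.ofForm ∘ₗ C.d))
      simp only [(ℛ k b).convMul_apply] at this
      change _ = C.ofForm (C.d b) at this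
      rw [← this]
      exact sum_mem fun i _ => Submodule.mul_mem_mul ⟨_, rfl⟩ ⟨_, rfl⟩
    rw [FirstOrderCalculus.ofForm_smul]
    refine mul_le_mul' C.range_ofAlg_mul_range_ofAlg le_rfl ?_
    rw [mul_assoc]
    exact Submodule.mul_mem_mul ⟨a, rfl⟩ hb
  | h0 => rw [map_zero]; exact zero_mem _
  | hadd x y hx hy => rw [map_add]; exact add_mem hx hy

/-- A coefficient to the right of an invariant 1-form is absorbed into a 1-form, which is expanded
again with its coefficients on the left; repeating this moves coefficients past all `n` factors. -/
theorem invForms_pow_mul_le (n : ℕ) : C.invForms ^ n * LinearMap.range C.ofAlg.toLinearMap ≤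
    LinearMap.range C.ofAlg.toLinearMap * C.invForms ^ n := by
  induction n with
  | zero => simp
  | succ n ih =>
    have h : C.invForms * LinearMap.range C.ofAlg.toLinearMap ≤
        LinearMap.range C.ofAlg.toLinearMap * C.invForms :=
      (mul_le_mul' C.invForms_le le_rfl).trans
        (C.range_ofForm_mul_range_ofAlg.trans C.range_ofForm_le)
    rw [pow_succ, mul_assoc]
    refine (mul_le_mul' le_rfl h).trans ?_
    rw [← mul_assoc, ← mul_assoc]
    exact mul_le_mul' ih le_rfl

theorem degree_le (n : ℕ) :
    C.degree n ≤ LinearMap.range C.ofAlg.toLinearMap * C.invForms ^ n := by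
  induction n with
  | zero => rw [FirstOrderCalculus.degree_zero, pow_zero, mul_one]
  | succ n ih =>
    rw [FirstOrderCalculus.degree_succ]
    refine (mul_le_mul' ih C.range_ofForm_le).trans ?_
    rw [← mul_assoc, mul_assoc _ (C.invForms ^ n)]
    refine (mul_le_mul' (mul_le_mul' le_rfl (C.invForms_pow_mul_le n)) le_rfl).trans ?_
    rw [← mul_assoc, mul_assoc, pow_succ]
    exact mul_le_mul' C.range_ofAlg_mul_range_ofAlg le_rfl

/-- The map `ω ↦ S(ω₋₁) ω₀`. -/
def coinvProj : C.MaxProlongation →ₗ[k] C.MaxProlongation :=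
  LinearMap.mul' k C.MaxProlongation ∘ₗ
    TensorProduct.map (C.ofAlg.toLinearMap ∘ₗ antipode k) LinearMap.id ∘ₗ C.coact.toLinearMap

/-- As `θ` coacts trivially, the left side is `S(h₁)h₂θ`. -/
theorem coinvProj_ofAlg_mul (h : H) (θ : C.Coinv) :
    C.coinvProj (C.ofAlg h * θ) = counit (R := k) h • (θ : C.MaxProlongation) := by
  have hθ : C.coact (θ : C.MaxProlongation) = 1 ⊗ₜ (θ : C.MaxProlongation) := θ.2
  simp only [coinvProj, LinearMap.comp_apply, AlgHom.toLinearMap_apply, map_mul, hθ, coact_ofAlg,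
    coactAlg_apply]
  have h1 := congrArg (fun f => f.ofConv h) C.toConv_antipode_mul
  simp only [(ℛ k h).convMul_apply] at h1
  rw [← (ℛ k h).eq]
  have h2 := congrArg (· * (θ : C.MaxProlongation)) h1
  simpa [Finset.sum_mul, mul_assoc, Algebra.smul_def] using h2

theorem coinvProj_coe (θ : C.Coinv) : C.coinvProj θ = θ := by
  simpa using C.coinvProj_ofAlg_mul 1 θ

/-- The coinvariant forms are generated by the Maurer-Cartan forms. -/
theorem coinvDegree_eq (n : ℕ) :
    C.coinvDegree n = LinearMap.range C.maurerCartanProj ^ n := by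
  have hpow : (LinearMap.range C.maurerCartanProj ^ n).map C.Coinv.val.toLinearMap =
      C.invForms ^ n := by
    rw [Submodule.map_pow, map_range_maurerCartanProj]
  refine le_antisymm (fun θ hθ => ?_) ?_
  -- By `hpow` the elements of `invForms ^ n` are coinvariant, so `coinvProj` replaces their
  -- coefficients by scalars. It fixes `θ`, which lies in the left side by `degree_le`.
  · have h : LinearMap.range C.ofAlg.toLinearMap * C.invForms ^ n ≤
        (C.invForms ^ n).comap C.coinvProj := by
      refine Submodule.mul_le.2 ?_
      rintro _ ⟨a, rfl⟩ x hx
      have hx' := hx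
      rw [← hpow] at hx'
      obtain ⟨η, -, rfl⟩ := hx'
      rw [Submodule.mem_comap]
      change C.coinvProj (C.ofAlg a * (η : C.MaxProlongation)) ∈ _
      rw [coinvProj_ofAlg_mul]
      exact Submodule.smul_mem _ _ hx
    have h1 := h (C.degree_le n hθ)
    rw [Submodule.mem_comap] at h1
    have h2 : (θ : C.MaxProlongation) ∈ C.invForms ^ n := by
      rwa [← C.coinvProj_coe θ]
    rw [← hpow] at h2
    obtain ⟨η, hη, h3⟩ := h2
    rwa [← Subtype.ext h3]
  · induction n with
    | zero =>
      rw [pow_zero, Submodule.one_eq_span, Submodule.span_singleton_le_iff_mem]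
      exact C.one_mem_coinvDegree
    | succ n ih =>
      rw [pow_succ, Submodule.mul_le]
      rintro θ hθ _ ⟨h, rfl⟩
      exact C.coinv_mul_mem rfl (ih (by rw [Submodule.map_pow, map_range_maurerCartanProj]) hθ)
        (C.maurerCartanProj_mem h)

end LeftCovariantCalculus

/-! ### Sweedler formulas for the product and the differential of vertical forms. -/

open Coalgebra HopfAlgebra WithConv

theorem exists_fin_sum_tmul {k V W : Type*} [Field k] [AddCommGroup V] [Module k V]
    [AddCommGroup W] [Module k W] (t : V ⊗[k] W) :
    ∃ (n : ℕ) (v : Fin n → V) (w : Fin n → W), t = ∑ i, v i ⊗ₜ[k] w i := by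
  obtain ⟨S, rfl⟩ := TensorProduct.exists_finset t
  refine ⟨S.card, fun i => (S.equivFin.symm i).1.1, fun i => (S.equivFin.symm i).1.2, ?_⟩
  rw [← Finset.sum_coe_sort, ← S.equivFin.symm.sum_comp]

section Vertical

variable {k H A Γ : Type*} [Field k] [Ring H] [HopfAlgebra k H] [Ring A] [Algebra k A]
  [AddCommGroup Γ] [Module k Γ] [Module H Γ] [Module Hᵐᵒᵖ Γ] [SMulCommClass H Hᵐᵒᵖ Γ]
  [IsScalarTower k H Γ] [IsScalarTower k Hᵐᵒᵖ Γ]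
  (P : RightComoduleAlgebra k H A) (C : LeftCovariantCalculus k H Γ)

theorem verWedge_tmul (a b : A) (θ η : C.Coinv) {n : ℕ} (b₀ : Fin n → A) (b₁ : Fin n → H)
    (hb : P.coact b = ∑ i, b₀ i ⊗ₜ[k] b₁ i) : verWedge P C (a ⊗ₜ[k] θ) (b ⊗ₜ[k] η) =
      ∑ i, (a * b₀ i) ⊗ₜ[k] (C.hook θ (b₁ i) * η) := by
  simp [verWedge, verCoact, hb, TensorProduct.sum_tmul, TensorProduct.map₂_apply_tmul, hookMul]

theorem verD_tmul (a : A) (θ : C.Coinv) {n : ℕ} (a₀ : Fin n → A) (a₁ : Fin n → H)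
    (ha : P.coact a = ∑ i, a₀ i ⊗ₜ[k] a₁ i) : verD P C (a ⊗ₜ[k] θ) = a ⊗ₜ[k] C.dCoinv θ +
      ∑ i, a₀ i ⊗ₜ[k] (C.maurerCartanProj (a₁ i) * θ) := by
  simp [verD, verCoact, ha, TensorProduct.sum_tmul]

/-! ### The embedding of the vertical forms into `A ⊗ Γ^∧` -/

/-- Given `f, g : H → E`, the composition of the coaction with `a ⊗ h ↦ a₀ ⊗ f(a₁) g(h)` is the
coaction followed by the convolution product of `f` and `g`. -/
theorem sum_lTensor_coact_mul {E : Type*} [Ring E] [Algebra k E] (f g : H →ₗ[k] E) (b : A)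
    {n : ℕ} (b₀ : Fin n → A) (b₁ : Fin n → H) (hb : P.coact b = ∑ i, b₀ i ⊗ₜ[k] b₁ i) :
    ∑ i, LinearMap.lTensor A f (P.coact (b₀ i)) * ((1 : A) ⊗ₜ[k] g (b₁ i)) =
      LinearMap.lTensor A (toConv f * toConv g).ofConv (P.coact b) := by
  -- `T` sends `a ⊗ h` to `a₀ ⊗ f(a₁)g(h)`; coassociativity turns `T ∘ Δ_A` into the convolution
  -- along `Δ_A`.
  let T : A ⊗[k] H →ₗ[k] A ⊗[k] E :=
    LinearMap.lTensor A (LinearMap.mul' k E ∘ₗ TensorProduct.map f g) ∘ₗ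
      (TensorProduct.assoc k A H H).toLinearMap ∘ₗ LinearMap.rTensor H P.coact.toLinearMap
  have hT (a : A) (h : H) : T (a ⊗ₜ h) =
      LinearMap.lTensor A f (P.coact a) * ((1 : A) ⊗ₜ[k] g h) := by
    simp only [T, LinearMap.comp_apply, LinearMap.rTensor_tmul, AlgHom.toLinearMap_apply]
    induction P.coact a using TensorProduct.induction_on with
    | zero => simp
    | add x y hx hy => simp only [TensorProduct.add_tmul, map_add, hx, hy, add_mul]
    | tmul x y => simp
  have h := congrArg (LinearMap.lTensor A (LinearMap.mul' k E ∘ₗ TensorProduct.map f g))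
    (DFunLike.congr_fun P.coassoc b)
  change T (P.coact b) = _ at h
  rw [LinearMap.comp_apply (LinearMap.lTensor A comul), ← LinearMap.lTensor_comp_apply] at h
  simp only [← hT, ← map_sum, ← hb]
  exact h

/-- The algebra map `a ↦ a₀ ⊗ a₁` with values in `A ⊗ Γ^∧`. -/
def coactForms : A →ₐ[k] A ⊗[k] C.MaxProlongation :=
  (Algebra.TensorProduct.map (AlgHom.id k A) C.ofAlg).comp P.coact

theorem coactForms_apply (a : A) :
    coactForms P C a = LinearMap.lTensor A C.ofAlg.toLinearMap (P.coact a) := rfl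

/-- The map `a ⊗ θ ↦ a₀ ⊗ a₁ θ` from vertical forms to `A ⊗ Γ^∧`. -/
def verEmbed : Ver P C →ₗ[k] A ⊗[k] C.MaxProlongation :=
  TensorProduct.lift ((LinearMap.mul k (A ⊗[k] C.MaxProlongation)).compl₁₂
    (coactForms P C).toLinearMap
    (TensorProduct.mk k A C.MaxProlongation 1 ∘ₗ C.Coinv.val.toLinearMap))

@[simp] theorem verEmbed_tmul (a : A) (θ : C.Coinv) : verEmbed P C (a ⊗ₜ[k] θ) =
    coactForms P C a * ((1 : A) ⊗ₜ[k] (θ : C.MaxProlongation)) := rfl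

/-- The comodule form of `toConv_mul_twist`: `b₀ ⊗ b₁S(b₂)φ(b₃) = b₀ ⊗ φ(b₁)`. -/
theorem sum_coactForms_mul_twist (φ : H →ₗ[k] C.MaxProlongation) (b : A) {n : ℕ}
    (b₀ : Fin n → A) (b₁ : Fin n → H) (hb : P.coact b = ∑ i, b₀ i ⊗ₜ[k] b₁ i) :
    ∑ i, coactForms P C (b₀ i) * ((1 : A) ⊗ₜ[k] C.twist φ (b₁ i)) =
      LinearMap.lTensor A φ (P.coact b) := by
  have h := sum_lTensor_coact_mul P C.ofAlg.toLinearMap (C.twist φ) b b₀ b₁ hb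
  rwa [C.toConv_mul_twist] at h

/-- The embedding is multiplicative. -/
theorem verEmbed_verWedge (x y : Ver P C) :
    verEmbed P C (verWedge P C x y) = verEmbed P C x * verEmbed P C y := by
  induction x using TensorProduct.induction_on with
  | zero => simp
  | add x x' hx hx' => simp only [map_add, LinearMap.add_apply, hx, hx', add_mul]
  | tmul a θ =>
    induction y using TensorProduct.induction_on with
    | zero => simp
    | add y y' hy hy' => simp only [map_add, hy, hy', mul_add]
    | tmul b η =>
      obtain ⟨n, b₀, b₁, hb⟩ := exists_fin_sum_tmul (P.coact b)
      -- The case `φ(h) = θh`: `b₀ ⊗ b₁(θ ↼ b₂) = b₀ ⊗ θb₁`. The twist in the wedge product is what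
      -- moving `θ` past the embedded `b` costs.
      have key : ∑ i, coactForms P C (b₀ i) *
          ((1 : A) ⊗ₜ[k] (C.hook θ (b₁ i) : C.MaxProlongation)) =
          ((1 : A) ⊗ₜ[k] (θ : C.MaxProlongation)) * coactForms P C b := by
        simp only [C.coe_hook]
        rw [sum_coactForms_mul_twist P C _ b b₀ b₁ hb, coactForms_apply]
        induction P.coact b using TensorProduct.induction_on with
        | zero => simp
        | add x y hx hy => simp only [map_add, hx, hy, mul_add]
        | tmul x y => simp
      rw [verWedge_tmul P C a b θ η b₀ b₁ hb, map_sum, verEmbed_tmul, verEmbed_tmul, mul_assoc,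
        ← mul_assoc _ (coactForms P C b), ← key, Finset.sum_mul, Finset.mul_sum]
      refine Finset.sum_congr rfl fun i _ => ?_
      rw [verEmbed_tmul, map_mul, mul_assoc, mul_assoc, Algebra.TensorProduct.tmul_mul_tmul,
        one_mul]
      rfl

/-- No sign occurs because the left factor has form degree 0. -/
theorem lTensor_dMax_mul_tmul (x : A ⊗[k] H) (y : C.MaxProlongation) :
    LinearMap.lTensor A C.dMax
      (LinearMap.lTensor A C.ofAlg.toLinearMap x * ((1 : A) ⊗ₜ[k] y)) =
    LinearMap.lTensor A (C.ofForm ∘ₗ C.d) x * ((1 : A) ⊗ₜ[k] y) +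
      LinearMap.lTensor A C.ofAlg.toLinearMap x * ((1 : A) ⊗ₜ[k] C.dMax y) := by
  induction x using TensorProduct.induction_on with
  | zero => simp
  | add x x' hx hx' => simp only [map_add, add_mul, hx, hx']; abel
  | tmul a h => simp [FirstOrderCalculus.dMax_mul, TensorProduct.tmul_add]

/-- The embedding is a map of complexes. -/
theorem verEmbed_verD (x : Ver P C) :
    verEmbed P C (verD P C x) = LinearMap.lTensor A C.dMax (verEmbed P C x) := by
  induction x using TensorProduct.induction_on with
  | zero => simp
  | add x x' hx hx' => simp only [map_add, hx, hx']
  | tmul a θ =>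
    obtain ⟨n, a₀, a₁, ha⟩ := exists_fin_sum_tmul (P.coact a)
    -- The case `φ = d`: the Maurer-Cartan term of `verD` accounts for differentiating the
    -- coefficient `a₁` in `a₀ ⊗ a₁θ`.
    have key : ∑ i, coactForms P C (a₀ i) *
        ((1 : A) ⊗ₜ[k] (C.maurerCartanProj (a₁ i) : C.MaxProlongation)) =
        LinearMap.lTensor A (C.ofForm ∘ₗ C.d) (P.coact a) := by
      simp only [C.coe_maurerCartanProj]
      exact sum_coactForms_mul_twist P C _ a a₀ a₁ ha
    rw [verD_tmul P C a θ a₀ a₁ ha, map_add, map_sum, verEmbed_tmul, verEmbed_tmul,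
      coactForms_apply, lTensor_dMax_mul_tmul, ← key, Finset.sum_mul, add_comm]
    congr 1
    refine Finset.sum_congr rfl fun i _ => ?_
    rw [verEmbed_tmul, mul_assoc, Algebra.TensorProduct.tmul_mul_tmul, one_mul]
    rfl

/-- The map `a ⊗ ω ↦ a₀ ⊗ S(a₁) ω`. -/
def verRetract : A ⊗[k] C.MaxProlongation →ₗ[k] A ⊗[k] C.MaxProlongation :=
  TensorProduct.lift ((LinearMap.mul k (A ⊗[k] C.MaxProlongation)).compl₁₂
    (LinearMap.lTensor A (C.ofAlg.toLinearMap ∘ₗ antipode k) ∘ₗ P.coact.toLinearMap)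
    (TensorProduct.mk k A C.MaxProlongation 1))

@[simp] theorem verRetract_tmul (a : A) (ω : C.MaxProlongation) : verRetract P C (a ⊗ₜ[k] ω) =
    LinearMap.lTensor A (C.ofAlg.toLinearMap ∘ₗ antipode k) (P.coact a) * ((1 : A) ⊗ₜ[k] ω) :=
  rfl

theorem verRetract_mul (x : A ⊗[k] C.MaxProlongation) (ω : C.MaxProlongation) :
    verRetract P C (x * ((1 : A) ⊗ₜ[k] ω)) = verRetract P C x * ((1 : A) ⊗ₜ[k] ω) := by
  induction x using TensorProduct.induction_on with
  | zero => simp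
  | add x x' hx hx' => simp only [add_mul, map_add, hx, hx']
  | tmul a η => simp [mul_assoc]

theorem lTensor_unit_counit_coact {E : Type*} [Ring E] [Algebra k E] (a : A) :
    LinearMap.lTensor A (Algebra.linearMap k E ∘ₗ counit (R := k) (A := H)) (P.coact a) =
      a ⊗ₜ[k] 1 := by
  have h := congrArg (LinearMap.lTensor A (Algebra.linearMap k E))
    (DFunLike.congr_fun P.counit a)
  rw [LinearMap.comp_apply, ← LinearMap.lTensor_comp_apply] at h
  simpa using h

/-- `a₀ ⊗ S(a₁)a₂ = a₀ ⊗ ε(a₁)1`, again a convolution along the coaction. -/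
theorem verRetract_coactForms (a : A) : verRetract P C (coactForms P C a) = a ⊗ₜ[k] 1 := by
  obtain ⟨n, a₀, a₁, ha⟩ := exists_fin_sum_tmul (P.coact a)
  have h := sum_lTensor_coact_mul P (C.ofAlg.toLinearMap ∘ₗ antipode k) C.ofAlg.toLinearMap
    a a₀ a₁ ha
  rw [C.toConv_antipode_mul] at h
  refine Eq.trans ?_ (h.trans (lTensor_unit_counit_coact P a))
  simp [coactForms_apply, ha]

theorem verRetract_verEmbed (x : Ver P C) : verRetract P C (verEmbed P C x) =
    LinearMap.lTensor A C.Coinv.val.toLinearMap x := by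
  induction x using TensorProduct.induction_on with
  | zero => simp
  | add x x' hx hx' => simp only [map_add, hx, hx']
  | tmul a θ => rw [verEmbed_tmul, verRetract_mul, verRetract_coactForms]; simp

/-- Followed by `verRetract` it is the inclusion `A ⊗ Λ → A ⊗ Γ^∧`, which is injective because `A`
is flat over the field. -/
theorem verEmbed_injective : Function.Injective (verEmbed P C) := by
  have h : Function.Injective (LinearMap.lTensor A C.Coinv.val.toLinearMap) :=
    Module.Flat.lTensor_preserves_injective_linearMap _ Subtype.val_injective
  intro x y hxy
  apply h
  rw [← verRetract_verEmbed, ← verRetract_verEmbed, hxy]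

/-! ### The algebraic laws -/

theorem tmul_mem_verDegree {n : ℕ} (a : A) {θ : C.Coinv} (hθ : θ ∈ C.coinvDegree n) :
    a ⊗ₜ[k] θ ∈ verDegree P C n :=
  ⟨a ⊗ₜ[k] (⟨θ, hθ⟩ : C.coinvDegree n), by simp⟩

/-- A linear statement about vertical forms of degree `n` may be checked on elementary tensors. -/
theorem verDegree_induction {n : ℕ} {p : ∀ x : Ver P C, x ∈ verDegree P C n → Prop}
    (h : ∀ (a : A) (θ : C.Coinv) (hθ : θ ∈ C.coinvDegree n),
      p (a ⊗ₜ[k] θ) (tmul_mem_verDegree P C a hθ)) (h0 : p 0 (zero_mem _))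
    (hadd : ∀ x y hx hy, p x hx → p y hy → p (x + y) (add_mem hx hy))
    {x : Ver P C} (hx : x ∈ verDegree P C n) : p x hx := by
  obtain ⟨t, rfl⟩ := hx
  induction t using TensorProduct.induction_on with
  | zero => simpa using h0
  | add s t hs ht =>
    simpa only [map_add] using hadd _ _ ⟨s, rfl⟩ ⟨t, rfl⟩ hs ht
  | tmul a θ => exact h a θ θ.2

theorem verWedge_mem {m n : ℕ} {x y : Ver P C} (hx : x ∈ verDegree P C m)
    (hy : y ∈ verDegree P C n) : verWedge P C x y ∈ verDegree P C (m + n) := by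
  induction hx using verDegree_induction P C with
  | h a θ hθ =>
    induction hy using verDegree_induction P C with
    | h b η hη =>
      obtain ⟨l, b₀, b₁, hb⟩ := exists_fin_sum_tmul (P.coact b)
      rw [verWedge_tmul P C a b θ η b₀ b₁ hb]
      exact sum_mem fun i _ => tmul_mem_verDegree P C _
        (C.coinv_mul_mem rfl (C.hook_mem hθ _) hη)
    | h0 => rw [map_zero]; exact zero_mem _
    | hadd x y _ _ hx hy => rw [map_add]; exact add_mem hx hy
  | h0 => rw [map_zero, LinearMap.zero_apply]; exact zero_mem _
  | hadd x y _ _ hx hy => rw [map_add, LinearMap.add_apply]; exact add_mem hx hy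

theorem verD_mem {n : ℕ} {x : Ver P C} (hx : x ∈ verDegree P C n) :
    verD P C x ∈ verDegree P C (n + 1) := by
  induction hx using verDegree_induction P C with
  | h a θ hθ =>
    obtain ⟨l, a₀, a₁, ha⟩ := exists_fin_sum_tmul (P.coact a)
    rw [verD_tmul P C a θ a₀ a₁ ha]
    exact add_mem (tmul_mem_verDegree P C a (C.dCoinv_mem hθ))
      (sum_mem fun i _ => tmul_mem_verDegree P C _
        (C.coinv_mul_mem (add_comm 1 n) (C.maurerCartanProj_mem _) hθ))
  | h0 => rw [map_zero]; exact zero_mem _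
  | hadd x y _ _ hx hy => rw [map_add]; exact add_mem hx hy

theorem isInternal_verDegree : DirectSum.IsInternal (verDegree P C) := by
  refine isInternal_of_projections _ (fun n => LinearMap.lTensor A (C.coinvComponent n))
    (fun n x hx => ?_) (fun m n hmn x hx => ?_) (eq_top_iff.2 fun x _ => ?_)
  · induction hx using verDegree_induction P C with
    | h a θ hθ => rw [LinearMap.lTensor_tmul, C.coinvComponent_of_mem hθ]
    | h0 => rw [map_zero]
    | hadd x y _ _ hx hy => rw [map_add, hx, hy]
  · induction hx using verDegree_induction P C with
    | h a θ hθ =>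
      rw [LinearMap.lTensor_tmul, C.coinvComponent_of_mem_of_ne hmn hθ, TensorProduct.tmul_zero]
    | h0 => rw [map_zero]
    | hadd x y _ _ hx hy => rw [map_add, hx, hy, add_zero]
  · induction x using TensorProduct.induction_on with
    | zero => exact zero_mem _
    | add x y hx hy => exact add_mem (hx trivial) (hy trivial)
    | tmul a θ =>
      have hθ : θ ∈ ⨆ n, C.coinvDegree n := by rw [C.iSup_coinvDegree]; trivial
      refine Submodule.iSup_induction _ (motive := fun θ => a ⊗ₜ[k] θ ∈ ⨆ n, verDegree P C n)
        hθ (fun n θ hθ => Submodule.mem_iSup_of_mem n (tmul_mem_verDegree P C a hθ)) ?_ ?_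
      · rw [TensorProduct.tmul_zero]; exact zero_mem _
      · intro θ η hθ hη
        rw [TensorProduct.tmul_add]
        exact add_mem hθ hη

theorem verEmbed_verIncl (a : A) : verEmbed P C (verIncl P C a) = coactForms P C a := by
  change coactForms P C a * 1 = _
  rw [mul_one]

/-- Multiplying `θ` by `a₁` keeps its degree, so `x` embeds into `A ⊗ Γ^{∧n}`, where the sign of the
Leibniz rule is `(-1)ⁿ`. -/
theorem lTensor_dMax_mul_of_mem {n : ℕ} {x : Ver P C} (hx : x ∈ verDegree P C n)
    (y : A ⊗[k] C.MaxProlongation) :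
    LinearMap.lTensor A C.dMax (verEmbed P C x * y) =
      LinearMap.lTensor A C.dMax (verEmbed P C x) * y +
        (-1 : k) ^ n • (verEmbed P C x * LinearMap.lTensor A C.dMax y) := by
  induction hx using verDegree_induction P C with
  | h a θ hθ =>
    rw [verEmbed_tmul, coactForms_apply]
    induction P.coact a using TensorProduct.induction_on with
    | zero => simp
    | add x x' hx hx' => simp only [map_add, add_mul, hx, hx', smul_add]; abel
    | tmul b h =>
      induction y using TensorProduct.induction_on with
      | zero => simp
      | add y y' hy hy' => simp only [map_add, mul_add, hy, hy', smul_add]; abel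
      | tmul c η =>
        have hmem : C.ofAlg h * (θ : C.MaxProlongation) ∈ C.degree n :=
          C.mul_mem_degree (zero_add n) (C.ofAlg_mem_degree h) hθ
        simp [C.dMax_mul_of_mem hmem, TensorProduct.tmul_add]
  | h0 => simp
  | hadd x x' _ _ hx hx' => simp only [map_add, add_mul, hx, hx', smul_add]; abel

/-- Each identity is verified after applying the injective map `verEmbed`, where the product is that
of a tensor product algebra and the differential is `id ⊗ d`. -/
theorem isDGA_ver : IsDGA (verDegree P C) (verWedge P C) (verIncl P C 1) (verD P C) where
  isInternal := isInternal_verDegree P C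
  wedge_mem := verWedge_mem P C
  d_mem := verD_mem P C
  wedge_assoc x y z := verEmbed_injective P C <| by simp only [verEmbed_verWedge, mul_assoc]
  one_wedge x := verEmbed_injective P C <| by
    rw [verEmbed_verWedge, verEmbed_verIncl, map_one, one_mul]
  wedge_one x := verEmbed_injective P C <| by
    rw [verEmbed_verWedge, verEmbed_verIncl, map_one, mul_one]
  d_d x := verEmbed_injective P C <| by
    have h : C.dMax ∘ₗ C.dMax = 0 := LinearMap.ext C.dMax_dMax
    rw [verEmbed_verD, verEmbed_verD, ← LinearMap.lTensor_comp_apply, h]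
    simp
  leibniz y hx := verEmbed_injective P C <| by
    simp only [verEmbed_verD, verEmbed_verWedge, map_add, map_smul,
      lTensor_dMax_mul_of_mem P C hx]

/-! ### Degree zero -/

theorem verIncl_injective : Function.Injective (verIncl P C) := by
  -- A linear functional with `f 1 = 1`, so that `id ⊗ f` splits `a ↦ a ⊗ 1`.
  let f : C.Coinv →ₗ[k] k := counit ∘ₗ C.toAlg.toLinearMap ∘ₗ C.Coinv.val.toLinearMap
  have h : Function.LeftInverse (TensorProduct.rid k A ∘ LinearMap.lTensor A f)
      (verIncl P C) := fun a => by simp [verIncl, f]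
  exact h.injective

theorem range_verIncl : LinearMap.range (verIncl P C) = verDegree P C 0 := by
  refine le_antisymm ?_ fun x hx => ?_
  · rintro _ ⟨a, rfl⟩
    exact tmul_mem_verDegree P C a C.one_mem_coinvDegree
  · induction hx using verDegree_induction P C with
    | h a θ hθ =>
      rw [C.coinvDegree_zero] at hθ
      obtain ⟨c, rfl⟩ := Submodule.mem_span_singleton.1 hθ
      exact ⟨c • a, by simp [verIncl]⟩
    | h0 => exact zero_mem _
    | hadd x y _ _ hx hy => exact add_mem hx hy

theorem verIncl_mul (a b : A) :
    verIncl P C (a * b) = verWedge P C (verIncl P C a) (verIncl P C b) :=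
  verEmbed_injective P C <| by simp only [verEmbed_verWedge, verEmbed_verIncl, map_mul]

/-! ### Generation by exact forms -/

theorem dCoinv_one : C.dCoinv 1 = 0 := Subtype.ext <| by
  have h := C.dMax_ofAlg 1
  rw [map_one, C.d_one, map_zero] at h
  exact h

/-- The argument on the right is `χ(a ⊗ b)`: this is where the canonical map meets the calculus. -/
theorem verWedge_incl_verD_incl (a b : A) :
    verWedge P C (verIncl P C a) (verD P C (verIncl P C b)) =
      LinearMap.lTensor A C.maurerCartanProj ((a ⊗ₜ[k] (1 : H)) * P.coact b) := by
  obtain ⟨n, b₀, b₁, hb⟩ := exists_fin_sum_tmul (P.coact b)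
  have hd : verD P C (verIncl P C b) = LinearMap.lTensor A C.maurerCartanProj (P.coact b) := by
    change verD P C (b ⊗ₜ[k] 1) = _
    rw [verD_tmul P C b 1 b₀ b₁ hb, dCoinv_one, TensorProduct.tmul_zero, zero_add, hb]
    simp
  rw [hd]
  refine verEmbed_injective P C ?_
  rw [verEmbed_verWedge, verEmbed_verIncl]
  induction P.coact b using TensorProduct.induction_on with
  | zero => simp
  | add x y hx hy => simp only [map_add, mul_add, hx, hy]
  | tmul x y => simp [mul_assoc]

/-- All 1-forms are combinations of `a ∧ d b`, by surjectivity of the canonical map. -/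
theorem tmul_maurerCartanProj_mem_span (hP : Function.Surjective P.canonicalMap) (a : A) (h : H) :
    a ⊗ₜ[k] C.maurerCartanProj h ∈ Submodule.span k
      {x | ∃ b c : A, x = verWedge P C (verIncl P C b) (verD P C (verIncl P C c))} := by
  -- A preimage under `χ`, lifted to `A ⊗ A`, writes the given form as a finite sum of `b ∧ dc`.
  obtain ⟨t, ht⟩ := hP (a ⊗ₜ[k] h)
  obtain ⟨t, rfl⟩ := QuotientAddGroup.mk_surjective t
  change P.canonicalMapAux t = _ at ht
  have hmem : LinearMap.lTensor A C.maurerCartanProj (P.canonicalMapAux t) ∈ Submodule.span k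
      {x | ∃ b c : A, x = verWedge P C (verIncl P C b) (verD P C (verIncl P C c))} := by
    clear ht
    induction t using TensorProduct.induction_on with
    | zero => rw [map_zero, map_zero]; exact zero_mem _
    | add x y hx hy => rw [map_add, map_add]; exact add_mem hx hy
    | tmul b c =>
      exact Submodule.subset_span ⟨b, c, (verWedge_incl_verD_incl P C b c).symm⟩
  rwa [ht] at hmem

/-- The form `a⁰ ∧ d a¹ ∧ ⋯ ∧ d aⁿ`. -/
abbrev exactForm (a₀ : A) {n : ℕ} (a : Fin n → A) : Ver P C :=
  (List.ofFn a).foldl (fun ω b => verWedge P C ω (verD P C (verIncl P C b))) (verIncl P C a₀)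

theorem exactForm_snoc (a₀ : A) {n : ℕ} (a : Fin n → A) (b : A) :
    exactForm P C a₀ (Fin.snoc a b : Fin (n + 1) → A) =
      verWedge P C (exactForm P C a₀ a) (verD P C (verIncl P C b)) := by
  simp only [exactForm, List.ofFn_succ', List.concat_eq_append, List.foldl_append]
  simp

theorem exactForm_mem (a₀ : A) {n : ℕ} (a : Fin n → A) :
    exactForm P C a₀ a ∈ verDegree P C n := by
  induction n with
  | zero =>
    rw [← range_verIncl]
    exact ⟨a₀, by simp [exactForm]⟩
  | succ n ih =>
    rw [← Fin.snoc_init_self a, exactForm_snoc]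
    refine verWedge_mem P C (ih _) (verD_mem P C (n := 0) ?_)
    rw [← range_verIncl]
    exact ⟨_, rfl⟩

/-- Nothing is twisted because `Δ_A(1) = 1 ⊗ 1`; this allows the last factor of a product in `Λ` to
be split off. -/
theorem verWedge_one_tmul (a : A) (θ η : C.Coinv) :
    verWedge P C (a ⊗ₜ[k] θ) ((1 : A) ⊗ₜ[k] η) = a ⊗ₜ[k] (θ * η) :=
  verEmbed_injective P C <| by
    rw [verEmbed_verWedge, verEmbed_tmul, verEmbed_tmul, verEmbed_tmul, map_one, one_mul,
      mul_assoc, Algebra.TensorProduct.tmul_mul_tmul, one_mul]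
    rfl

theorem verDegree_eq_span (hP : Function.Surjective P.canonicalMap) (n : ℕ) :
    verDegree P C n =
      Submodule.span k {x | ∃ (a₀ : A) (a : Fin n → A), x = exactForm P C a₀ a} := by
  refine le_antisymm ?_ (Submodule.span_le.2 ?_)
  · induction n with
    | zero =>
      rw [← range_verIncl]
      rintro _ ⟨a, rfl⟩
      exact Submodule.subset_span ⟨a, Fin.elim0, by simp [exactForm]⟩
    | succ n ih =>
      set X := Submodule.span k
        {x | ∃ (a₀ : A) (a : Fin (n + 1) → A), x = exactForm P C a₀ a} with hX
      -- By induction `x` is a combination of `a⁰ ∧ da¹ ∧ ⋯ ∧ daⁿ`; wedging with `db` appends one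
      -- factor.
      have hstep {x : Ver P C} (hx : x ∈ verDegree P C n) (b : A) :
          verWedge P C x (verD P C (verIncl P C b)) ∈ X := by
        refine Submodule.span_induction
          (p := fun x _ => verWedge P C x (verD P C (verIncl P C b)) ∈ X) ?_ ?_ ?_ ?_ (ih hx)
        · rintro _ ⟨a₀, a, rfl⟩
          exact Submodule.subset_span ⟨a₀, Fin.snoc a b, (exactForm_snoc P C a₀ a b).symm⟩
        · rw [map_zero, LinearMap.zero_apply]; exact zero_mem _
        · intro x y _ _ hx hy
          rw [map_add, LinearMap.add_apply]; exact add_mem hx hy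
        · intro c x _ hx
          rw [map_smul, LinearMap.smul_apply]; exact Submodule.smul_mem _ c hx
      have hone {x : Ver P C} (hx : x ∈ verDegree P C n) (h : H) :
          verWedge P C x ((1 : A) ⊗ₜ[k] C.maurerCartanProj h) ∈ X := by
        have hle : Submodule.span k
            {y | ∃ b c : A, y = verWedge P C (verIncl P C b) (verD P C (verIncl P C c))} ≤
            X.comap (verWedge P C x) := by
          refine Submodule.span_le.2 ?_
          rintro _ ⟨b, c, rfl⟩
          change verWedge P C x _ ∈ X
          -- In `x ∧ (b ∧ dc) = (x ∧ b) ∧ dc` the factor `x ∧ b` still has degree `n`, so `hstep`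
          -- applies.
          rw [← (isDGA_ver P C).wedge_assoc]
          refine hstep ?_ c
          refine verWedge_mem P C (n := 0) hx ?_
          rw [← range_verIncl]
          exact ⟨b, rfl⟩
        exact hle (tmul_maurerCartanProj_mem_span P C hP 1 h)
      intro x hx
      induction hx using verDegree_induction P C with
      | h a θ hθ =>
        -- `Λⁿ⁺¹ = Λⁿ · ϖ(H⁺)`, so it suffices to treat `θ · ϖ(π_ε(h))` with `θ` of degree `n`.
        rw [C.coinvDegree_eq, pow_succ, ← C.coinvDegree_eq] at hθ
        refine Submodule.mul_induction_on hθ ?_ (fun θ η hθ hη => by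
          rw [TensorProduct.tmul_add]; exact add_mem hθ hη)
        rintro θ hθ _ ⟨h, rfl⟩
        rw [← verWedge_one_tmul P C]
        exact hone (tmul_mem_verDegree P C a hθ) h
      | h0 => exact zero_mem _
      | hadd x y _ _ hx hy => exact add_mem hx hy
  · rintro _ ⟨a₀, a, rfl⟩
    exact exactForm_mem P C a₀ a

theorem isDifferentialCalculus_ver (hP : Function.Surjective P.canonicalMap) :
    IsDifferentialCalculus (verDegree P C) (verWedge P C) (verD P C) (verIncl P C) where
  toIsDGA := isDGA_ver P C
  incl_injective := verIncl_injective P C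
  range_incl := range_verIncl P C
  incl_mul := verIncl_mul P C
  span_eq := verDegree_eq_span P C hP

end Vertical

end QPB

end

/-! ### The theorem; its first two clauses pin down product and differential for every expansion of
the coaction. -/

theorem mainTheorem1 {k H A Γ : Type*} [Field k] [Ring H] [HopfAlgebra k H]
    [Ring A] [Algebra k A] [AddCommGroup Γ] [Module k Γ] [Module H Γ] [Module Hᵐᵒᵖ Γ]
    [SMulCommClass H Hᵐᵒᵖ Γ] [IsScalarTower k H Γ] [IsScalarTower k Hᵐᵒᵖ Γ]
    (P : QPB.RightComoduleAlgebra k H A) (hP : P.IsQuantumPrincipalBundle)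
    (C : QPB.BicovariantCalculus k H Γ) :
    (∀ (a b : A) (θ η : C.Coinv) (n : ℕ) (b₀ : Fin n → A) (b₁ : Fin n → H),
      P.coact b = ∑ i, b₀ i ⊗ₜ[k] b₁ i →
      QPB.verWedge P C.toLeftCovariantCalculus (a ⊗ₜ[k] θ) (b ⊗ₜ[k] η) =
        ∑ i, (a * b₀ i) ⊗ₜ[k] (C.hook θ (b₁ i) * η)) ∧
    (∀ (a : A) (θ : C.Coinv) (n : ℕ) (a₀ : Fin n → A) (a₁ : Fin n → H),
      P.coact a = ∑ i, a₀ i ⊗ₜ[k] a₁ i →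
      QPB.verD P C.toLeftCovariantCalculus (a ⊗ₜ[k] θ) =
        a ⊗ₜ[k] C.dCoinv θ +
          ∑ i, a₀ i ⊗ₜ[k] (C.maurerCartan (QPB.LeftCovariantCalculus.projAug (a₁ i)) * θ)) ∧
    QPB.IsDifferentialCalculus (QPB.verDegree P C.toLeftCovariantCalculus)
      (QPB.verWedge P C.toLeftCovariantCalculus) (QPB.verD P C.toLeftCovariantCalculus)
      (QPB.verIncl P C.toLeftCovariantCalculus) :=
  ⟨fun a b θ η _ b₀ b₁ hb => QPB.verWedge_tmul P _ a b θ η b₀ b₁ hb,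
    fun a θ _ a₀ a₁ ha => QPB.verD_tmul P _ a θ a₀ a₁ ha,
    QPB.isDifferentialCalculus_ver P _ hP.galois.surjective⟩
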